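/- Let $N\in\mathbb{N}$ with $N>1$, let $\mathbb{Q}_N=\{p/N^k : p\in\mathbb{Z},\,k\in\mathbb{N}\}$ with the discrete topology, and let $\alpha=(\alpha_n)_{n\in\mathbb{N}}$ be a sequence of real numbers with $\alpha_0\in[0,1)$ such that for every $n$ there is $j\in\{0,\dots,N-1\}$ with $N\alpha_{n+1}=\alpha_n+j$. Let $\mathscr{A}^{\mathscr{S}}_\alpha=C^*(\mathbb{Q}_N^2,\Psi_\alpha)$ be the twisted group C*-algebra of $\mathbb{Q}_N^2$ for the multiplier $$\Psi_\alpha\left(\left(\tfrac{p_1}{N^{k_1}},\tfrac{p_2}{N^{k_2}}\right),\left(\tfrac{p_3}{N^{k_3}},\tfrac{p_4}{N^{k_4}}\right)\right)=\exp(2i\pi\,\alpha_{k_1+k_4}\,p_1p_4),$$ that is, the universal C*-algebra generated by unitaries $W_g$ ($g\in\mathbb{Q}_N^2$) with $W_gW_h=\Psi_\alpha(g,h)W_{g+h}$. For $M\in\mathbb{N}$, $M>1$, let $\mathscr{S}_M=\{(z_n)_{n\in\mathbb{N}}\in\mathbb{T}^{\mathbb{N}} : z_{n+1}^M=z_n \text{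 for all } n\}$ be the $M$-solenoid group, with the topology induced from $\mathbb{T}^{\mathbb{N}}$. Assume that the sequence $\alpha$ is periodic (there is $j>0$ with $\alpha_{n+j}=\alpha_n$ for all $n$) and that $\alpha_0=\frac pq$ with $p,q$ nonzero, relatively prime natural numbers. Let $k$ be the smallest nonzero natural number such that $(N^k-1)\alpha_0\in\mathbb{Z}$, and let $\lambda=\exp(2i\pi p/q)$. Then $\lambda^{N^k}=\lambda$, so that $\lambda z=(\lambda z_n)_{n}$ belongs to $\mathscr{S}_{N^k}$ for every $z=(z_n)_n\in\mathscr{S}_{N^k}$. Let $u_\lambda,v_\lambda\in M_q(\mathbb{C})$ be the unitaries $u_\lambda=\mathrm{diag}(1,\lambda,\lambda^2,\dots,\lambda^{q-1})$ and $v_\lambda e_j=e_{j+1}$ (indices modulo $q$), where $e_0,\dots,e_{q-1}$ is the standard basis of $\mathbb{C}^q$; they satisfy $u_\lambda v_\lambda=\lambda v_\lambda u_\lambda$. Then: 1. There is a locally trivial bundle of C*-algebras with base space $\mathscr{S}_{N^k}^2$ and fibre $M_q(\mathbb{C})$ whose C*-algebra of continuous sections is $*$-isomorphic to $\mathscr{A}^{\mathscr{S}}_\alpha$.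 2. More precisely, $\mathscr{A}^{\mathscr{S}}_\alpha$ is $*$-isomorphic to the fixed-point algebra of $C(\mathscr{S}_{N^k}^2,M_q(\mathbb{C}))$ under the action $\rho$ of $(\mathbb{Z}/q\mathbb{Z})^2$ by $*$-automorphisms given, for $(n,m)\in(\mathbb{Z}/q\mathbb{Z})^2$, $\zeta\in C(\mathscr{S}_{N^k}^2,M_q(\mathbb{C}))$ and $(z,w)\in\mathscr{S}_{N^k}^2$, by $$\rho_{(n,m)}(\zeta)(z,w)=v_\lambda^{-m}u_\lambda^{-n}\,\zeta(\lambda^{-n}z,\lambda^{-m}w)\,u_\lambda^{n}v_\lambda^{m}.$$ -/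

import Mathlib

open scoped ENNReal ComplexOrder

noncomputable section

/-! ### Twisted group C*-algebras -/

/-- A `σ`-representation of a group `G`, where `σ` is a circle-valued multiplier: unitaries `W g`
of a nonzero unital C*-algebra with `W g * W h = σ (g, h) W (g + h)`. -/
structure ProjRep (G : Type) [AddGroup G] (σ : G → G → Circle) : Type 1 where
  carrier : Type
  [cstar : CStarAlgebra carrier]
  [nontrivial : Nontrivial carrier]
  W : G → carrier
  unitary' : ∀ g, W g ∈ unitary carrier
  mul' : ∀ g h, W g * W h = (σ g h : ℂ) • W (g + h)

attribute [instance] ProjRep.cstar ProjRep.nontrivial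

section TwistedGroupAlgebra

variable (G : Type) [AddGroup G] (σ : G → G → Circle)

/-- The C*-algebra of bounded families indexed by all `σ`-representations, with pointwise
operations and the supremum norm. -/
abbrev RepProduct : Type 1 := lp (fun R : ProjRep G σ => R.carrier) ∞

instance RepProduct.cstarAlgebra : CStarAlgebra (RepProduct G σ) where

/-- The family `(R.W g)_R` of the images of `g` in all `σ`-representations. -/
def universalFamily (g : G) : RepProduct G σ :=
  ⟨fun R => R.W g, memℓp_infty ⟨1, by
    rintro _ ⟨R, rfl⟩
    exact (CStarRing.norm_of_mem_unitary (R.unitary' g)).le⟩⟩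

/-- The twisted group C*-algebra `C*(G, σ)`: the universal C*-algebra generated by unitaries
`W g` (`g ∈ G`) with `W g * W h = σ (g, h) W (g + h)`, realised as the closed star-subalgebra
generated by the universal family. The norm of an element of the twisted group algebra is thus the
supremum of its norms in all `σ`-representations. -/
def twistedGroupCStar : StarSubalgebra ℂ (RepProduct G σ) :=
  (StarAlgebra.adjoin ℂ (Set.range (universalFamily G σ))).topologicalClosure

/-- The canonical unitaries `W g` of `C*(G, σ)`. -/
def twistedGroupCStar.W (g : G) : twistedGroupCStar G σ :=
  ⟨universalFamily G σ g, StarSubalgebra.le_topologicalClosure _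
    (StarAlgebra.subset_adjoin ℂ _ ⟨g, rfl⟩)⟩

instance : IsClosed (twistedGroupCStar G σ : Set (RepProduct G σ)) :=
  StarSubalgebra.isClosed_topologicalClosure _

/-- `C*(G, σ)` has the universal property of the C*-algebra generated by unitaries subject to the
defining relations. -/
theorem twistedGroupCStar.existsUnique_lift (R : ProjRep G σ) :
    ∃! π : twistedGroupCStar G σ →⋆ₐ[ℂ] R.carrier,
      ∀ g, π (twistedGroupCStar.W G σ g) = R.W g := by
  let ev : RepProduct G σ →⋆ₐ[ℂ] R.carrier :=
    { toFun := fun a => a R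
      map_one' := rfl
      map_mul' := fun _ _ => rfl
      map_zero' := rfl
      map_add' := fun _ _ => rfl
      commutes' := fun _ => rfl
      map_star' := fun _ => rfl }
  refine ⟨ev.comp (twistedGroupCStar G σ).subtype, fun g => rfl, fun π hπ => ?_⟩
  have hcont : ∀ τ : twistedGroupCStar G σ →⋆ₐ[ℂ] R.carrier, Continuous τ := fun τ =>
    AddMonoidHomClass.continuous_of_bound τ 1 fun a => by
      simpa using NonUnitalStarAlgHom.norm_apply_le τ a
  refine StarAlgHom.ext_topologicalClosure (hcont π) (hcont _) ?_
  refine StarAlgHom.ext_adjoin ?_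
  rintro ⟨_, h⟩ ⟨g, rfl⟩
  exact hπ g

end TwistedGroupAlgebra

/-! ### Noncommutative solenoids -/

/-- The group `ℚ_N = {p / N ^ k : p ∈ ℤ, k ∈ ℕ}` of `N`-adic rationals. -/
def NadicRat (N : ℕ) [NeZero N] : AddSubgroup ℚ where
  carrier := {x | ∃ (p : ℤ) (k : ℕ), x = p / (N : ℚ) ^ k}
  zero_mem' := ⟨0, 0, by simp⟩
  add_mem' := by
    rintro _ _ ⟨p, k, rfl⟩ ⟨p', k', rfl⟩
    have : (N : ℚ) ≠ 0 := by exact_mod_cast NeZero.ne N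
    refine ⟨p * N ^ k' + p' * N ^ k, k + k', ?_⟩
    push_cast
    field_simp
    ring
  neg_mem' := by
    rintro _ ⟨p, k, rfl⟩
    exact ⟨-p, k, by push_cast; ring⟩

/-- `Ξ_N`: the sequences `α` with `α 0 ∈ [0, 1)` such that for all `n` there is
`k ∈ {0, …, N - 1}` with `N α (n + 1) = α n + k`. -/
def Xi (N : ℕ) : Set (ℕ → ℝ) :=
  {α | α 0 ∈ Set.Ico (0 : ℝ) 1 ∧ ∀ n, ∃ k ∈ Finset.range N, N * α (n + 1) = α n + k}

section Multiplier

variable (N : ℕ) [NeZero N] (α : ℕ → ℝ)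

/-- The exponent `k` of a chosen expression `p / N ^ k` of an `N`-adic rational. -/
def NadicRat.exponent (x : NadicRat N) : ℕ := x.2.choose_spec.choose

/-- The numerator `p` of a chosen expression `p / N ^ k` of an `N`-adic rational. -/
def NadicRat.numerator (x : NadicRat N) : ℤ := x.2.choose

/-- The multiplier `Ψ_α` of `ℚ_N²`,
`Ψ_α ((p₁ / N ^ k₁, p₂ / N ^ k₂), (p₃ / N ^ k₃, p₄ / N ^ k₄)) = exp (2 i π α_{k₁ + k₄} p₁ p₄)`.
For `α ∈ Ξ_N` it does not depend on the chosen expressions, see `solenoidMultiplier_eq`. -/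
def solenoidMultiplier (x y : NadicRat N × NadicRat N) : Circle :=
  Circle.exp (2 * Real.pi *
    (α (NadicRat.exponent N x.1 + NadicRat.exponent N y.2) *
      NadicRat.numerator N x.1 * NadicRat.numerator N y.2))

theorem solenoidMultiplier_eq (hα : α ∈ Xi N) (x y : NadicRat N × NadicRat N)
    (p₁ p₄ : ℤ) (k₁ k₄ : ℕ) (hx : (x.1 : ℚ) = p₁ / (N : ℚ) ^ k₁)
    (hy : (y.2 : ℚ) = p₄ / (N : ℚ) ^ k₄) :
    solenoidMultiplier N α x y = Circle.exp (2 * Real.pi * (α (k₁ + k₄) * p₁ * p₄)) := by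
  have hN : (N : ℚ) ≠ 0 := by exact_mod_cast NeZero.ne N
  have step : ∀ n m : ℕ, ∃ j : ℤ, (N : ℝ) ^ m * α (n + m) = α n + j := by
    intro n m
    induction m with
    | zero => exact ⟨0, by simp⟩
    | succ m ih =>
      obtain ⟨j, hj⟩ := ih
      obtain ⟨k, -, hk⟩ := hα.2 (n + m)
      refine ⟨N ^ m * k + j, ?_⟩
      rw [pow_succ, mul_assoc, ← add_assoc, hk]
      push_cast
      linear_combination hj
  have hexp : ∀ (a b : ℝ) (j : ℤ), a = b + j →
      Circle.exp (2 * Real.pi * a) = Circle.exp (2 * Real.pi * b) := by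
    rintro _ b j rfl
    rw [mul_add, Circle.exp_add, Circle.exp_two_pi_mul_int, mul_one]
  have cross : ∀ (a b : ℤ) (k l : ℕ), (a : ℚ) / (N : ℚ) ^ k = b / (N : ℚ) ^ l →
      (a : ℝ) * (N : ℝ) ^ l = b * (N : ℝ) ^ k := by
    intro a b k l h
    rw [div_eq_div_iff (pow_ne_zero _ hN) (pow_ne_zero _ hN)] at h
    exact_mod_cast h
  have h1 := cross _ _ _ _ ((x.1.2.choose_spec.choose_spec).symm.trans hx)
  have h4 := cross _ _ _ _ ((y.2.2.choose_spec.choose_spec).symm.trans hy)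
  unfold solenoidMultiplier
  change _ = (p₁ : ℝ) * (N : ℝ) ^ (NadicRat.exponent N x.1) at h1
  change _ = (p₄ : ℝ) * (N : ℝ) ^ (NadicRat.exponent N y.2) at h4
  change ((NadicRat.numerator N x.1 : ℤ) : ℝ) * _ = _ at h1
  change ((NadicRat.numerator N y.2 : ℤ) : ℝ) * _ = _ at h4
  generalize NadicRat.numerator N x.1 = a₁ at *
  generalize NadicRat.numerator N y.2 = a₄ at *
  generalize NadicRat.exponent N x.1 = l₁ at *
  generalize NadicRat.exponent N y.2 = l₄ at *
  obtain ⟨j, hj⟩ := step (l₁ + l₄) (k₁ + k₄)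
  obtain ⟨i, hi⟩ := step (k₁ + k₄) (l₁ + l₄)
  rw [add_comm (k₁ + k₄)] at hi
  refine hexp _ _ (i * p₁ * p₄ - j * a₁ * a₄) ?_
  push_cast
  rw [pow_add] at hi hj
  linear_combination -(a₁ * a₄ : ℝ) * hj + (p₁ * p₄ : ℝ) * hi
    + α (l₁ + l₄ + (k₁ + k₄)) * (a₄ * (N : ℝ) ^ k₄ * h1 + p₁ * (N : ℝ) ^ l₁ * h4)

/-- The noncommutative solenoid `C*(ℚ_N², Ψ_α)`. -/
abbrev NoncommutativeSolenoid : Type 1 :=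
  twistedGroupCStar (NadicRat N × NadicRat N) (solenoidMultiplier N α)

end Multiplier

/-! ### Solenoid groups -/

/-- The `M`-solenoid group, with the topology induced from the product `Circle ^ ℕ`. -/
def Solenoid (M : ℕ) : Subgroup (ℕ → Circle) where
  carrier := {z | ∀ n, z (n + 1) ^ M = z n}
  one_mem' := by intro n; simp
  mul_mem' := by
    intro a b ha hb n
    simp only [Pi.mul_apply, mul_pow, ha n, hb n]
  inv_mem' := by
    intro a ha n
    simp only [Pi.inv_apply, inv_pow, ha n]

instance (M : ℕ) : CompactSpace (Solenoid M) := by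
  refine isCompact_iff_compactSpace.mp (IsClosed.isCompact ?_)
  have h : (Solenoid M : Set (ℕ → Circle)) = ⋂ n, {z | z (n + 1) ^ M = z n} := by
    ext z
    simp [Solenoid]
  rw [h]
  exact isClosed_iInter fun n => isClosed_eq (by fun_prop) (by fun_prop)

/-- The constant sequence `(c, c, …)`, as an element of the `M`-solenoid when `c ^ M = c`.
Multiplying a point by it multiplies every coordinate by `c`. -/
def Solenoid.const {M : ℕ} (c : Circle) (hc : c ^ M = c) : Solenoid M := ⟨fun _ => c, fun _ => hc⟩

/-! ### The action on matrix-valued functions -/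

/-- The C*-algebra of `q × q` complex matrices. -/
abbrev MatAlg (q : ℕ) : Type := CStarMatrix (Fin q) (Fin q) ℂ

/-- The clock matrix `diag (1, c, c², …, c ^ (q - 1))`. -/
def clockMatrix (q : ℕ) (c : Circle) : Matrix (Fin q) (Fin q) ℂ :=
  Matrix.diagonal fun i : Fin q => (c : ℂ) ^ (i : ℕ)

/-- The shift matrix, with entries `1` at `(j + 1, j)` (indices modulo `q`) and `0` elsewhere, so
that its first row is `(0, …, 0, 1)` and its second row is `(1, 0, …, 0)`. -/
def shiftMatrix (q : ℕ) [NeZero q] : Matrix (Fin q) (Fin q) ℂ :=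
  Matrix.of fun i j : Fin q => if i = j + 1 then 1 else 0

theorem clockMatrix_mem (q : ℕ) (c : Circle) :
    clockMatrix q c ∈ unitary (Matrix (Fin q) (Fin q) ℂ) := by
  have hc : (starRingEnd ℂ) (c : ℂ) * c = 1 := by
    rw [← Circle.coe_inv_eq_conj, ← Circle.coe_mul, inv_mul_cancel, Circle.coe_one]
  have h : ∀ n : ℕ, (starRingEnd ℂ) (c : ℂ) ^ n * (c : ℂ) ^ n = 1 := fun n => by
    rw [← mul_pow, hc, one_pow]
  rw [Unitary.mem_iff, clockMatrix, Matrix.star_eq_conjTranspose, Matrix.diagonal_conjTranspose,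
    Matrix.diagonal_mul_diagonal, Matrix.diagonal_mul_diagonal, ← Matrix.diagonal_one]
  constructor
  · congr 1
    ext i
    simpa using h i
  · congr 1
    ext i
    simpa [mul_comm] using h i

theorem shiftMatrix_mem (q : ℕ) [NeZero q] :
    shiftMatrix q ∈ unitary (Matrix (Fin q) (Fin q) ℂ) := by
  have h : ∀ a b : Fin q, a = b + 1 ↔ b = a - 1 := fun a b =>
    ⟨fun h => by rw [h, add_sub_cancel_right], fun h => by rw [h, sub_add_cancel]⟩
  rw [Unitary.mem_iff, shiftMatrix, Matrix.star_eq_conjTranspose]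
  constructor
  · ext i j
    simp [Matrix.mul_apply, Matrix.one_apply, eq_comm]
  · ext i j
    simp [Matrix.mul_apply, Matrix.one_apply, h, eq_comm]

theorem clockMatrix_mul_shiftMatrix (q : ℕ) [NeZero q] (c : Circle) (hc : c ^ q = 1) :
    clockMatrix q c * shiftMatrix q = (c : ℂ) • (shiftMatrix q * clockMatrix q c) := by
  have hc' : (c : ℂ) ^ q = 1 := by rw [← Circle.coe_pow, hc, Circle.coe_one]
  ext i j
  rw [clockMatrix, shiftMatrix, Matrix.diagonal_mul, Matrix.smul_apply, Matrix.mul_diagonal]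
  by_cases h : i = j + 1
  · subst h
    simp only [Matrix.of_apply, if_true, mul_one, one_mul, smul_eq_mul]
    rw [← pow_succ', Fin.val_add, Fin.val_one', Nat.add_mod_mod, ← pow_mod_orderOf,
      Nat.mod_mod_of_dvd _ (orderOf_dvd_of_pow_eq_one hc'), pow_mod_orderOf]
  · simp [h]

theorem clockMatrix_pow (q : ℕ) (c : Circle) (hc : c ^ q = 1) : clockMatrix q c ^ q = 1 := by
  have hc' : (c : ℂ) ^ q = 1 := by rw [← Circle.coe_pow, hc, Circle.coe_one]
  rw [clockMatrix, Matrix.diagonal_pow, ← Matrix.diagonal_one]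
  congr 1
  ext i
  simp only [Pi.pow_apply]
  rw [← pow_mul, mul_comm, pow_mul, hc', one_pow]

theorem shiftMatrix_pow (q : ℕ) [NeZero q] : shiftMatrix q ^ q = 1 := by
  have h : ∀ n : ℕ, shiftMatrix q ^ n =
      Matrix.of fun i j : Fin q => if i = j + Fin.ofNat q n then 1 else 0 := by
    intro n
    induction n with
    | zero =>
      ext i j
      simp [Matrix.one_apply]
    | succ n ih =>
      have h1 : Fin.ofNat q (n + 1) = 1 + Fin.ofNat q n := by
        ext
        simp [Fin.val_add, add_comm]
      ext i j
      rw [pow_succ, ih, h1]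
      simp [shiftMatrix, Matrix.mul_apply, add_comm, add_left_comm]
  rw [h]
  ext i j
  simp [Matrix.one_apply]

/-- The clock matrix `u`, as a unitary of the C*-algebra of matrices. -/
def clock (q : ℕ) (c : Circle) : unitary (MatAlg q) :=
  ⟨CStarMatrix.ofMatrix (clockMatrix q c), clockMatrix_mem q c⟩

/-- The shift matrix `v`, as a unitary of the C*-algebra of matrices. -/
def shift (q : ℕ) [NeZero q] : unitary (MatAlg q) :=
  ⟨CStarMatrix.ofMatrix (shiftMatrix q), shiftMatrix_mem q⟩

section Action

variable (q M : ℕ) [NeZero q] (c : Circle) (hM : c ^ M = c)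

/-- The C*-algebra of continuous functions from the square of the `M`-solenoid to the
`q × q` matrices. -/
abbrev MatFun : Type := C(Solenoid M × Solenoid M, MatAlg q)

/-- Conjugation by the inverse of `uⁿ vᵐ`. -/
def conjAut (n m : ZMod q) : MatAlg q ≃⋆ₐ[ℂ] MatAlg q :=
  Unitary.conjStarAlgAut ℂ (MatAlg q) ((clock q c ^ n.val * shift q ^ m.val)⁻¹)

theorem conjAut_apply (n m : ZMod q) (a : MatAlg q) :
    conjAut q c n m a =
      (((shift q ^ m.val)⁻¹ : unitary (MatAlg q)) : MatAlg q) *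
        (((clock q c ^ n.val)⁻¹ : unitary (MatAlg q)) : MatAlg q) * a *
        ((clock q c ^ n.val : unitary (MatAlg q)) : MatAlg q) *
        ((shift q ^ m.val : unitary (MatAlg q)) : MatAlg q) := by
  rw [conjAut, Unitary.conjStarAlgAut_apply, ← Unitary.coe_star, Unitary.star_eq_inv, inv_inv,
    mul_inv_rev, Submonoid.coe_mul, Submonoid.coe_mul]
  simp only [mul_assoc]

/-- The endomorphism `ρ_{(n, m)}`, with
`ρ_{(n, m)} ζ (z, w) = v⁻ᵐ u⁻ⁿ ζ (c⁻ⁿ z, c⁻ᵐ w) uⁿ vᵐ`. -/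
def rhoHom (n m : ZMod q) : MatFun q M →⋆ₐ[ℂ] MatFun q M where
  toFun ζ :=
    { toFun := fun x =>
        (((shift q ^ m.val)⁻¹ : unitary (MatAlg q)) : MatAlg q) *
          (((clock q c ^ n.val)⁻¹ : unitary (MatAlg q)) : MatAlg q) *
          ζ ((Solenoid.const c hM ^ n.val)⁻¹ * x.1, (Solenoid.const c hM ^ m.val)⁻¹ * x.2) *
          ((clock q c ^ n.val : unitary (MatAlg q)) : MatAlg q) *
          ((shift q ^ m.val : unitary (MatAlg q)) : MatAlg q)
      continuous_toFun := by fun_prop }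
  map_one' := by
    ext1 x
    exact (conjAut_apply q c n m _).symm.trans (map_one _)
  map_mul' ζ ξ := by
    ext1 x
    simp only [ContinuousMap.coe_mk, ContinuousMap.mul_apply, ← conjAut_apply, map_mul]
  map_zero' := by
    ext1 x
    exact (conjAut_apply q c n m _).symm.trans (map_zero _)
  map_add' ζ ξ := by
    ext1 x
    simp only [ContinuousMap.coe_mk, ContinuousMap.add_apply, ← conjAut_apply, map_add]
  commutes' r := by
    ext1 x
    rw [Algebra.algebraMap_eq_smul_one]
    simp only [ContinuousMap.coe_mk, ContinuousMap.smul_apply, ContinuousMap.one_apply,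
      ← conjAut_apply, map_smul, map_one]
  map_star' ζ := by
    ext1 x
    simp only [ContinuousMap.coe_mk, ContinuousMap.star_apply, ← conjAut_apply, map_star]

theorem rhoHom_apply (n m : ZMod q) (ζ : MatFun q M) (x : Solenoid M × Solenoid M) :
    rhoHom q M c hM n m ζ x = conjAut q c n m
      (ζ ((Solenoid.const c hM ^ n.val)⁻¹ * x.1, (Solenoid.const c hM ^ m.val)⁻¹ * x.2)) :=
  (conjAut_apply q c n m _).symm

theorem pow_zmod_val_add {Γ : Type*} [Monoid Γ] (a : Γ) (ha : a ^ q = 1) (n m : ZMod q) :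
    a ^ (n + m).val = a ^ n.val * a ^ m.val := by
  rw [ZMod.val_add, ← pow_eq_pow_mod _ ha, pow_add]

theorem conjAut_add (hq : c ^ q = 1) (n m n' m' : ZMod q) :
    conjAut q c (n + n') (m + m') = conjAut q c n m * conjAut q c n' m' := by
  have hu : clock q c ^ q = 1 := by
    ext1
    exact (map_pow (CStarMatrix.ofMatrixStarAlgEquiv (n := Fin q) (A := ℂ))
      (clockMatrix q c) q).symm.trans
      (by rw [clockMatrix_pow q c hq, map_one]; rfl)
  have hv : shift q ^ q = 1 := by
    ext1
    exact (map_pow (CStarMatrix.ofMatrixStarAlgEquiv (n := Fin q) (A := ℂ))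
      (shiftMatrix q) q).symm.trans
      (by rw [shiftMatrix_pow q, map_one]; rfl)
  have huv : ((clock q c * shift q : unitary (MatAlg q)) : MatAlg q)
      = (c : ℂ) • ((shift q * clock q c : unitary (MatAlg q)) : MatAlg q) :=
    congrArg CStarMatrix.ofMatrix (clockMatrix_mul_shiftMatrix q c hq)
  let Ad := Unitary.conjStarAlgAut ℂ (MatAlg q)
  have hcomm : Commute (Ad (clock q c)) (Ad (shift q)) := by
    change Ad _ * Ad _ = Ad _ * Ad _
    rw [← map_mul, ← map_mul]
    ext1 a
    rw [Unitary.conjStarAlgAut_apply, Unitary.conjStarAlgAut_apply, huv, star_smul]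
    simp only [smul_mul_assoc, mul_smul_comm, smul_smul]
    have hc : (c : ℂ) * star (c : ℂ) = 1 := by
      change (c : ℂ) * (starRingEnd ℂ) (c : ℂ) = 1
      rw [← Circle.coe_inv_eq_conj, ← Circle.coe_mul, mul_inv_cancel, Circle.coe_one]
    rw [mul_comm, hc, one_smul]
  have key : ∀ n m : ZMod q, conjAut q c n m =
      (Ad (clock q c) ^ n.val * Ad (shift q) ^ m.val)⁻¹ := by
    intro n m
    rw [← map_pow, ← map_pow, ← map_mul, ← map_inv]
    rfl
  rw [key, key, key, pow_zmod_val_add q _ (by rw [← map_pow, hu, map_one]),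
    pow_zmod_val_add q _ (by rw [← map_pow, hv, map_one]), ← mul_inv_rev]
  congr 1
  have h1 := hcomm.pow_pow n.val m'.val
  have h2 := hcomm.pow_pow n.val m.val
  have h3 := hcomm.pow_pow n'.val m.val
  have h4 := (Commute.refl (Ad (shift q))).pow_pow m.val m'.val
  have h5 := (Commute.refl (Ad (clock q c))).pow_pow n.val n'.val
  generalize Ad (clock q c) ^ n.val = a at *
  generalize Ad (clock q c) ^ n'.val = a' at *
  generalize Ad (shift q) ^ m.val = b at *
  generalize Ad (shift q) ^ m'.val = b' at *
  calc a * a' * (b * b') = a' * a * (b' * b) := by rw [h5.eq, h4.eq]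
    _ = a' * (a * b') * b := by simp only [mul_assoc]
    _ = a' * (b' * a) * b := by rw [h1.eq]
    _ = a' * b' * (a * b) := by simp only [mul_assoc]

theorem rhoHom_comp (hq : c ^ q = 1) (n m n' m' : ZMod q) (ζ : MatFun q M) :
    rhoHom q M c hM n m (rhoHom q M c hM n' m' ζ) = rhoHom q M c hM (n + n') (m + m') ζ := by
  have hs : Solenoid.const c hM ^ q = 1 := by
    ext k
    exact congrArg (fun z : Circle => (z : ℂ)) hq
  ext1 x
  rw [rhoHom_apply, rhoHom_apply, rhoHom_apply, conjAut_add q c hq, pow_zmod_val_add q _ hs,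
    pow_zmod_val_add q _ hs, mul_inv, mul_inv]
  change _ = (conjAut q c n m) ((conjAut q c n' m') _)
  simp only [← mul_assoc]
  rw [mul_comm (Solenoid.const c hM ^ n'.val)⁻¹, mul_comm (Solenoid.const c hM ^ m'.val)⁻¹]
  rfl

theorem rhoHom_zero (ζ : MatFun q M) : rhoHom q M c hM 0 0 ζ = ζ := by
  ext1 x
  rw [rhoHom_apply]
  simp [conjAut]

/-- The action `ρ` of `(ℤ / q ℤ)²` by star-automorphisms. -/
def rho (hq : c ^ q = 1) : Multiplicative (ZMod q × ZMod q) →* (MatFun q M ≃⋆ₐ[ℂ] MatFun q M) where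
  toFun g := StarAlgEquiv.ofStarAlgHom (rhoHom q M c hM g.toAdd.1 g.toAdd.2)
    (rhoHom q M c hM (-g.toAdd.1) (-g.toAdd.2))
    (by
      ext1 ζ
      rw [StarAlgHom.comp_apply, rhoHom_comp q M c hM hq, neg_add_cancel, neg_add_cancel, rhoHom_zero]
      rfl)
    (by
      ext1 ζ
      rw [StarAlgHom.comp_apply, rhoHom_comp q M c hM hq, add_neg_cancel, add_neg_cancel, rhoHom_zero]
      rfl)
  map_one' := by
    ext1 ζ
    exact rhoHom_zero q M c hM ζ
  map_mul' g h := by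
    ext1 ζ
    exact (rhoHom_comp q M c hM hq _ _ _ _ ζ).symm

end Action

/-- The fixed-point algebra of an action of a group by star-automorphisms. -/
def fixedPointAlgebra {Γ A : Type*} [Group Γ] [Semiring A] [StarRing A] [Algebra ℂ A]
    [StarModule ℂ A] (ρ : Γ →* (A ≃⋆ₐ[ℂ] A)) : StarSubalgebra ℂ A where
  carrier := {a | ∀ g, ρ g a = a}
  mul_mem' := fun ha hb g => by rw [map_mul, ha g, hb g]
  add_mem' := fun ha hb g => by rw [map_add, ha g, hb g]
  algebraMap_mem' := fun r g => by
    rw [Algebra.algebraMap_eq_smul_one, map_smul, map_one]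
  star_mem' := fun ha g => by rw [map_star, ha g]

/-! ### Bundles of matrix algebras -/

/-- A locally trivial bundle of C*-algebras over `B` with fibre the `q × q` matrices: the local
trivialisations are star-isomorphisms on each fibre. -/
structure MatrixBundle (B : Type) [TopologicalSpace B] (q : ℕ) where
  fiber : B → Type
  [cstar : ∀ b, CStarAlgebra (fiber b)]
  [topTotal : TopologicalSpace (Bundle.TotalSpace (MatAlg q) fiber)]
  locallyTrivial : ∀ b, ∃ e : Bundle.Trivialization (MatAlg q)
      (Bundle.TotalSpace.proj : Bundle.TotalSpace (MatAlg q) fiber → B),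
    b ∈ e.baseSet ∧ ∀ x ∈ e.baseSet, ∃ φ : fiber x ≃⋆ₐ[ℂ] MatAlg q,
      ∀ y : fiber x, (e ⟨x, y⟩).2 = φ y

attribute [instance] MatrixBundle.cstar MatrixBundle.topTotal

theorem MatrixBundle.continuousAt_iff {B : Type} [TopologicalSpace B] {q : ℕ}
    (E : MatrixBundle B q) {b : B} (e : Bundle.Trivialization (MatAlg q)
      (Bundle.TotalSpace.proj : Bundle.TotalSpace (MatAlg q) E.fiber → B))
    (hb : b ∈ e.baseSet) (s : ∀ b, E.fiber b) :
    ContinuousAt (fun x => (⟨x, s x⟩ : Bundle.TotalSpace (MatAlg q) E.fiber)) b ↔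
      ContinuousAt (fun x => (e ⟨x, s x⟩).2) b := by
  rw [ContinuousAt, e.tendsto_nhds_iff (e.mem_source.mpr hb)]
  exact and_iff_right continuousAt_id

/-- The star-algebra of continuous sections of a bundle of matrix algebras, with pointwise
operations. -/
def MatrixBundle.sections {B : Type} [TopologicalSpace B] {q : ℕ} (E : MatrixBundle B q) :
    StarSubalgebra ℂ (∀ b, E.fiber b) where
  carrier := {s | Continuous fun b => (⟨b, s b⟩ : Bundle.TotalSpace (MatAlg q) E.fiber)}
  mul_mem' {s t} hs ht := continuous_iff_continuousAt.mpr fun b => by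
    obtain ⟨e, hb, he⟩ := E.locallyTrivial b
    rw [E.continuousAt_iff e hb]
    refine (((E.continuousAt_iff e hb s).mp hs.continuousAt).mul
      ((E.continuousAt_iff e hb t).mp ht.continuousAt)).congr ?_
    filter_upwards [e.open_baseSet.mem_nhds hb] with x hx
    obtain ⟨φ, hφ⟩ := he x hx
    rw [Pi.mul_apply, hφ, hφ, hφ, Pi.mul_apply, map_mul]
  add_mem' {s t} hs ht := continuous_iff_continuousAt.mpr fun b => by
    obtain ⟨e, hb, he⟩ := E.locallyTrivial b
    rw [E.continuousAt_iff e hb]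
    refine (((E.continuousAt_iff e hb s).mp hs.continuousAt).add
      ((E.continuousAt_iff e hb t).mp ht.continuousAt)).congr ?_
    filter_upwards [e.open_baseSet.mem_nhds hb] with x hx
    obtain ⟨φ, hφ⟩ := he x hx
    rw [Pi.add_apply, hφ, hφ, hφ, Pi.add_apply, map_add]
  algebraMap_mem' r := continuous_iff_continuousAt.mpr fun b => by
    obtain ⟨e, hb, he⟩ := E.locallyTrivial b
    rw [E.continuousAt_iff e hb]
    refine (continuousAt_const (y := r • (1 : MatAlg q))).congr ?_
    filter_upwards [e.open_baseSet.mem_nhds hb] with x hx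
    obtain ⟨φ, hφ⟩ := he x hx
    rw [hφ, Pi.algebraMap_apply, Algebra.algebraMap_eq_smul_one, map_smul, map_one]
  star_mem' {s} hs := continuous_iff_continuousAt.mpr fun b => by
    obtain ⟨e, hb, he⟩ := E.locallyTrivial b
    rw [E.continuousAt_iff e hb]
    refine ((E.continuousAt_iff e hb s).mp hs.continuousAt).star.congr ?_
    filter_upwards [e.open_baseSet.mem_nhds hb] with x hx
    obtain ⟨φ, hφ⟩ := he x hx
    rw [hφ, hφ, Pi.star_apply, map_star]

/-- The root of unity `exp (2 i π p / q)`. -/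
def rootOfUnity (p q : ℕ) : Circle := Circle.exp (2 * Real.pi * (p / q))

theorem rootOfUnity_pow (p q : ℕ) [NeZero q] : rootOfUnity p q ^ q = 1 := by
  have hq : (q : ℝ) ≠ 0 := by exact_mod_cast NeZero.ne q
  have h : (q : ℝ) * (2 * Real.pi * (p / q)) = 2 * Real.pi * ((p : ℤ) : ℝ) := by
    push_cast
    field_simp
  rw [rootOfUnity, ← Circle.exp_natCast_mul, h, Circle.exp_two_pi_mul_int]

theorem rootOfUnity_pow_of_int {N k p q : ℕ} {a : ℝ} (ha : a = p / q)
    (h : ∃ j : ℤ, ((N : ℝ) ^ k - 1) * a = j) :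
    rootOfUnity p q ^ (N ^ k) = rootOfUnity p q := by
  obtain ⟨j, hj⟩ := h
  have h : ((N ^ k : ℕ) : ℝ) * (2 * Real.pi * (p / q))
      = 2 * Real.pi * j + 2 * Real.pi * (p / q) := by
    push_cast
    rw [ha] at hj
    linear_combination 2 * Real.pi * hj
  rw [rootOfUnity, ← Circle.exp_natCast_mul, h, Circle.exp_add, Circle.exp_two_pi_mul_int, one_mul]

end

noncomputable section

/-! ### Characters of commutative C*-subalgebras -/

/-! Put λ = exp(2πip/q), M = N^k, and let S be the M-solenoid. As λ has order q and λ^M = λ, there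
is t with M = 1 + qt, so N is invertible modulo q. Periodicity then forces exp(2πi α_n) to be λ
raised to the residue N⁻ⁿ modulo q. Hence Ψ_α is the pullback of the bicharacter (x, y) ↦ λ^(x₁y₂)
of (ℤ/q)² along the residue map r induced by p/N^e ↦ p N⁻ᵉ (`solenoidMultiplier_eq_pow`).

Points of S are characters of the N-adic rationals. If χ_g is the function on S² attached to g, then
W_g ↦ χ_g · u^(r(g)₂) v^(-r(g)₁) is a representation π on C(S², M_q) with ρ-fixed values.

Faithfulness: summing the conjugates of `star a * a` by q² canonical unitaries representing (ℤ/q)²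
lands in the commutative C*-subalgebra generated by the W_g with r(g) = 0, and vanishes only if a =
0 (`sum_conj_mem`, `eq_zero_of_sum_unitary_conj_eq_zero`). So it suffices that π induces every
character of that subalgebra. Such a character restricts to a character of ker r, which is
evaluation at a point of S² because q-th roots exist in S (`exists_solenoidChar_eq`).

Surjectivity: summing over ρ kills χ_g u^a v^b unless it is an image of W_g. These functions have
dense span, so by closedness of the range the sum maps everything into the range of π
(`rhoSum_mem`); on fixed points it is multiplication by q².

Bundle: x ↦ x^q on S² has local sections, and its kernel is the finite group of constant pairs of
powers of λ. A function is ρ-fixed exactly when its values over each fibre of this map are related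
by conjugation with clock and shift powers (`mem_fixedPointAlgebra_iff`), so composing it with
branches of the q-th root gives a section of the bundle glued by those conjugations. -/

/-- A closed star-subalgebra generated by commuting elements with commuting adjoints has enough
characters to detect its nonzero elements. -/
theorem exists_starAlgHom_ne_zero {A : Type*} [CStarAlgebra A] {S : Set A}
    (hS : ∀ x ∈ S, ∀ y ∈ S, x * y = y * x) (hS' : ∀ x ∈ S, ∀ y ∈ S, x * star y = star y * x)
    (a : (StarAlgebra.adjoin ℂ S).topologicalClosure) (ha : a ≠ 0) :
    ∃ φ : (StarAlgebra.adjoin ℂ S).topologicalClosure →⋆ₐ[ℂ] ℂ, φ a ≠ 0 := by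
  have hcomm := StarAlgebra.isMulCommutative_adjoin ℂ hS hS'
  have : IsClosed ((StarAlgebra.adjoin ℂ S).topologicalClosure : Set A) :=
    StarSubalgebra.isClosed_topologicalClosure _
  have hmul : ∀ x y : (StarAlgebra.adjoin ℂ S).topologicalClosure, x * y = y * x :=
    ((StarAlgebra.adjoin ℂ S).commRingTopologicalClosure fun x y => hcomm.is_comm.comm x y).mul_comm
  let _ : CommCStarAlgebra (StarAlgebra.adjoin ℂ S).topologicalClosure :=
    { (inferInstance : CStarAlgebra (StarAlgebra.adjoin ℂ S).topologicalClosure) with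
      mul_comm := hmul }
  by_contra! h
  refine ha ((gelfandStarTransform _).injective ?_)
  rw [map_zero]
  ext φ
  let ψ : (StarAlgebra.adjoin ℂ S).topologicalClosure →⋆ₐ[ℂ] ℂ :=
    { toFun := fun x => φ x
      map_one' := map_one φ
      map_mul' := map_mul φ
      map_zero' := map_zero φ
      map_add' := map_add φ
      commutes' := fun r => AlgHomClass.commutes φ r
      map_star' := fun x => map_star φ x }
  exact h ψ

theorem StarAlgHom.continuous_of_cstar {A B : Type*} [CStarAlgebra A] [CStarAlgebra B]
    (f : A →⋆ₐ[ℂ] B) : Continuous f :=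
  AddMonoidHomClass.continuous_of_bound f 1 fun a => by
    simpa using NonUnitalStarAlgHom.norm_apply_le f a

/-- A star-homomorphism is injective on a commutative C*-subalgebra if every character of that
subalgebra is induced by it. -/
theorem eq_zero_of_characters_induced {A B : Type*} [CStarAlgebra A] [CStarAlgebra B] {S : Set A}
    (hS : ∀ x ∈ S, ∀ y ∈ S, x * y = y * x) (hS' : ∀ x ∈ S, ∀ y ∈ S, x * star y = star y * x)
    (π : A →⋆ₐ[ℂ] B)
    (hπ : ∀ φ : (StarAlgebra.adjoin ℂ S).topologicalClosure →⋆ₐ[ℂ] ℂ,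
      ∃ (D : Type) (_ : CStarAlgebra D) (_ : Nontrivial D) (ε : B →⋆ₐ[ℂ] D), ∀ x (hx : x ∈ S),
        ε (π x) = algebraMap ℂ D (φ ⟨x, StarSubalgebra.le_topologicalClosure _
          (StarAlgebra.subset_adjoin ℂ _ hx)⟩))
    (a : A) (ha : a ∈ (StarAlgebra.adjoin ℂ S).topologicalClosure) (h0 : π a = 0) : a = 0 := by
  have : IsClosed ((StarAlgebra.adjoin ℂ S).topologicalClosure : Set A) :=
    StarSubalgebra.isClosed_topologicalClosure _
  by_contra hne
  obtain ⟨φ, hφ⟩ := exists_starAlgHom_ne_zero hS hS' ⟨a, ha⟩ fun h => hne (congrArg Subtype.val h)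
  obtain ⟨D, _, _, ε, hε⟩ := hπ φ
  -- Both sides are continuous and agree on the generators, hence on the whole closed subalgebra; a
  -- character not vanishing at `a` then contradicts `π a = 0`.
  have heq : (ε.comp π).comp (StarAlgebra.adjoin ℂ S).topologicalClosure.subtype =
      (StarAlgHom.ofId ℂ D).comp φ := by
    refine StarAlgHom.ext_topologicalClosure (StarAlgHom.continuous_of_cstar _)
      (StarAlgHom.continuous_of_cstar _) (StarAlgHom.ext_adjoin ?_)
    rintro ⟨x, h⟩ hx
    exact hε x hx
  have h1 : ε (π a) = algebraMap ℂ D (φ ⟨a, ha⟩) := DFunLike.congr_fun heq ⟨a, ha⟩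
  rw [h0, map_zero] at h1
  exact hφ ((map_eq_zero (algebraMap ℂ D)).mp h1.symm)

/-- A sum of unitary conjugates of `star a * a` vanishes only if `a` does. -/
theorem eq_zero_of_sum_unitary_conj_eq_zero {A ι : Type*} [CStarAlgebra A] [Fintype ι] [Nonempty ι]
    (u : ι → A) (hu : ∀ i, u i ∈ unitary A) (a : A)
    (h0 : ∑ i, u i * (star a * a) * star (u i) = 0) : a = 0 := by
  let _ := CStarAlgebra.spectralOrder A
  have := CStarAlgebra.spectralOrderedRing A
  obtain ⟨i⟩ := (inferInstance : Nonempty ι)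
  -- In the spectral order each summand is positive, being `star y * y` for `y = a * star (u i)`, so
  -- a vanishing sum forces every term to vanish.
  rw [Finset.sum_eq_zero_iff_of_nonneg] at h0
  · have h1 := h0 i (Finset.mem_univ _)
    have hi := (Unitary.mem_iff.mp (hu i)).1
    have h2 : star a * a = 0 := by
      calc star a * a = (star (u i) * u i) * (star a * a) * (star (u i) * u i) := by
            rw [hi, one_mul, mul_one]
        _ = star (u i) * (u i * (star a * a) * star (u i)) * u i := by simp only [mul_assoc]
        _ = 0 := by rw [h1, mul_zero, zero_mul]
    exact CStarRing.star_mul_self_eq_zero_iff a |>.mp h2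
  · intro x _
    have := star_mul_self_nonneg (a * star (u x))
    rwa [star_mul, star_star, mul_assoc, ← mul_assoc (star a), ← mul_assoc] at this

/-! ### Twisted group algebras of bicharacters -/

namespace twistedGroupCStar

section General

variable {G : Type} [AddGroup G] {σ : G → G → Circle}

theorem W_mem_unitary (g : G) : W G σ g ∈ unitary (twistedGroupCStar G σ) := by
  have h : universalFamily G σ g ∈ unitary (RepProduct G σ) := by
    rw [Unitary.mem_iff]
    constructor <;> ext R
    · exact (Unitary.mem_iff.mp (R.unitary' g)).1
    · exact (Unitary.mem_iff.mp (R.unitary' g)).2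
  rw [Unitary.mem_iff] at h ⊢
  exact ⟨Subtype.ext h.1, Subtype.ext h.2⟩

theorem W_mul_W (g h : G) : W G σ g * W G σ h = (σ g h : ℂ) • W G σ (g + h) := by
  refine Subtype.ext ?_
  ext R
  exact R.mul' g h

theorem W_zero : W G σ 0 = (σ 0 0 : ℂ) • 1 := by
  have h := W_mul_W (σ := σ) (0 : G) 0
  have h1 := (Unitary.mem_iff.mp (W_mem_unitary (σ := σ) (0 : G))).1
  rw [add_zero] at h
  calc W G σ 0 = star (W G σ 0) * W G σ 0 * W G σ 0 := by rw [h1, one_mul]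
    _ = _ := by rw [mul_assoc, h, mul_smul_comm, h1]

/-- Makes the linear span of the canonical unitaries closed under the adjoint. The factor `σ 0 0`
enters because `W 0` is only a scalar multiple of 1. -/
theorem star_W (g : G) :
    star (W G σ g) = (((σ g (-g) * σ 0 0)⁻¹ : Circle) : ℂ) • W G σ (-g) := by
  have h1 := (Unitary.mem_iff.mp (W_mem_unitary (σ := σ) g)).1
  have h : W G σ g * W G σ (-g) = ((σ g (-g) * σ 0 0 : Circle) : ℂ) • 1 := by
    rw [W_mul_W, add_neg_cancel, W_zero, smul_smul, Circle.coe_mul]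
  have h2 : W G σ (-g) = ((σ g (-g) * σ 0 0 : Circle) : ℂ) • star (W G σ g) := by
    calc W G σ (-g) = star (W G σ g) * (W G σ g * W G σ (-g)) := by rw [← mul_assoc, h1, one_mul]
      _ = _ := by rw [h, mul_smul_comm, mul_one]
  rw [h2, smul_smul, ← Circle.coe_mul, inv_mul_cancel, Circle.coe_one, one_smul]

/-- The closed linear span of the canonical unitaries is everything. -/
theorem closure_span_W :
    closure (Submodule.span ℂ (Set.range (W G σ)) : Set (twistedGroupCStar G σ)) = Set.univ := by
  rw [Set.eq_univ_iff_forall]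
  set K := Submodule.span ℂ (Set.range (W G σ))
  have hW : ∀ g, W G σ g ∈ K := fun g => Submodule.subset_span ⟨g, rfl⟩
  have h1 : (1 : twistedGroupCStar G σ) ∈ K := by
    have := K.smul_mem (((σ 0 0)⁻¹ : Circle) : ℂ) (hW 0)
    rwa [W_zero, smul_smul, ← Circle.coe_mul, inv_mul_cancel, Circle.coe_one, one_smul] at this
  have hmul : ∀ x ∈ K, ∀ y ∈ K, x * y ∈ K := by
    intro x hx y hy
    have hK : K * K ≤ K := by
      rw [Submodule.span_mul_span, Submodule.span_le]
      rintro _ ⟨_, ⟨g, rfl⟩, _, ⟨h, rfl⟩, rfl⟩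
      change W G σ g * W G σ h ∈ K
      rw [W_mul_W]
      exact K.smul_mem _ (hW _)
    exact hK (Submodule.mul_mem_mul hx hy)
  have hstar : ∀ x ∈ K, star x ∈ K := by
    intro x hx
    induction hx using Submodule.span_induction with
    | mem x hx =>
      obtain ⟨g, rfl⟩ := hx
      rw [star_W]
      exact K.smul_mem _ (hW _)
    | zero => rw [star_zero]; exact K.zero_mem
    | add x y _ _ hx hy => rw [star_add]; exact K.add_mem hx hy
    | smul c x _ hx => rw [star_smul]; exact K.smul_mem _ hx
  intro a
  rw [closure_subtype]
  refine closure_mono ?_ a.2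
  intro x hx
  induction hx using StarAlgebra.adjoin_induction with
  | mem x hx =>
    obtain ⟨g, rfl⟩ := hx
    exact ⟨W G σ g, hW g, rfl⟩
  | algebraMap r => exact ⟨algebraMap ℂ _ r, by
      rw [Algebra.algebraMap_eq_smul_one]; exact K.smul_mem _ h1, rfl⟩
  | add x y _ _ hx hy =>
    obtain ⟨x, hx, rfl⟩ := hx
    obtain ⟨y, hy, rfl⟩ := hy
    exact ⟨x + y, K.add_mem hx hy, rfl⟩
  | mul x y _ _ hx hy =>
    obtain ⟨x, hx, rfl⟩ := hx
    obtain ⟨y, hy, rfl⟩ := hy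
    exact ⟨x * y, hmul x hx y hy, rfl⟩
  | star x _ hx =>
    obtain ⟨x, hx, rfl⟩ := hx
    exact ⟨star x, hstar x hx, rfl⟩

end General

end twistedGroupCStar

/-! ### Orthogonality of the characters of ℤ/q and (ℤ/q)². -/

theorem coe_sum_pow_zmod_mul (q : ℕ) [NeZero q] (c : Circle) (hc : orderOf c = q) (a : ZMod q) :
    ∑ n : ZMod q, ((c ^ (n * a).val : Circle) : ℂ) = if a = 0 then (q : ℂ) else 0 := by
  have hq : c ^ q = 1 := hc ▸ pow_orderOf_eq_one c
  let ψ : AddChar (ZMod q) ℂ :=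
    { toFun := fun n => ((c ^ (n * a).val : Circle) : ℂ)
      map_zero_eq_one' := by simp
      map_add_eq_mul' := fun n m => by
        rw [add_mul, pow_zmod_val_add q c hq, Circle.coe_mul] }
  split_ifs with h
  · subst h
    simp
  · refine AddChar.sum_eq_zero_of_ne_one (ψ := ψ) fun h1 => h ?_
    have h2 : ((c ^ ((1 : ZMod q) * a).val : Circle) : ℂ) = 1 := DFunLike.congr_fun h1 1
    rw [one_mul] at h2
    have h3 : c ^ a.val = 1 := by ext1; rw [h2, Circle.coe_one]
    have h4 := orderOf_dvd_of_pow_eq_one h3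
    rw [hc] at h4
    exact (ZMod.val_eq_zero a).mp (Nat.eq_zero_of_dvd_of_lt h4 (ZMod.val_lt a))

theorem coe_sum_pow_zmod_mul_add (q : ℕ) [NeZero q] (c : Circle) (hc : orderOf c = q)
    (a b : ZMod q) :
    ∑ x : ZMod q × ZMod q, ((c ^ (x.1 * a + x.2 * b).val : Circle) : ℂ) =
      if a = 0 ∧ b = 0 then (q : ℂ) ^ 2 else 0 := by
  have hq : c ^ q = 1 := hc ▸ pow_orderOf_eq_one c
  simp_rw [pow_zmod_val_add q c hq, Circle.coe_mul]
  rw [← Finset.univ_product_univ, Finset.sum_product]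
  simp_rw [← Finset.mul_sum, ← Finset.sum_mul, coe_sum_pow_zmod_mul q c hc]
  by_cases h1 : a = 0 <;> by_cases h2 : b = 0 <;> simp [h1, h2, sq]

/-! ### Multipliers pulled back from the standard bicharacter of (ℤ/q)². -/

namespace twistedGroupCStar

section Bicharacter

variable {G : Type} [AddCommGroup G] {σ : G → G → Circle} {q : ℕ} [NeZero q] {c : Circle}
  (hc : orderOf c = q) (r : G →+ ZMod q × ZMod q)
  (hσ : ∀ g h, σ g h = c ^ ((r g).1 * (r h).2).val)

include hc hσ

/-- Each canonical unitary is an eigenvector of the inner automorphisms by the others, with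
eigenvalue the antisymmetrised bicharacter. Its nondegeneracy drives the averaging argument. -/
theorem W_mul_W_mul_star (g h : G) :
    W G σ g * W G σ h * star (W G σ g) =
      ((c ^ ((r g).1 * (r h).2 + (r g).2 * -(r h).1).val : Circle) : ℂ) • W G σ h := by
  have hq : c ^ q = 1 := hc ▸ pow_orderOf_eq_one c
  have h1 : W G σ g * W G σ h =
      ((c ^ ((r g).1 * (r h).2 + (r g).2 * -(r h).1).val : Circle) : ℂ) •
        (W G σ h * W G σ g) := by
    rw [W_mul_W, W_mul_W, smul_smul, add_comm h g, hσ, hσ, ← Circle.coe_mul,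
      ← pow_zmod_val_add q c hq]
    congr 5
    ring
  rw [h1, smul_mul_assoc, mul_assoc, (Unitary.mem_iff.mp (W_mem_unitary (σ := σ) g)).2, mul_one]

/-- The average of an element over the inner automorphisms by canonical unitaries lies in the
closed subalgebra generated by the canonical unitaries of the kernel of `r`. -/
theorem sum_conj_mem (s : ZMod q × ZMod q → G) (hs : ∀ x, r (s x) = x)
    (a : twistedGroupCStar G σ) :
    ∑ x, W G σ (s x) * a * star (W G σ (s x)) ∈
      (StarAlgebra.adjoin ℂ (W G σ '' {g | r g = 0})).topologicalClosure := by
  set Z := (StarAlgebra.adjoin ℂ (W G σ '' {g | r g = 0})).topologicalClosure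
  have hZ : IsClosed (Z : Set (twistedGroupCStar G σ)) :=
    StarSubalgebra.isClosed_topologicalClosure _
  let E : twistedGroupCStar G σ →ₗ[ℂ] twistedGroupCStar G σ :=
    ∑ x, (LinearMap.mulRight ℂ (star (W G σ (s x)))).comp (LinearMap.mulLeft ℂ (W G σ (s x)))
  have hE : ∀ a, E a = ∑ x, W G σ (s x) * a * star (W G σ (s x)) := fun a => by
    simp [E]
  have hcont : Continuous E := by
    simp_rw [funext hE]
    fun_prop
  rw [← hE]
  have hle : Submodule.span ℂ (Set.range (W G σ)) ≤ Submodule.comap E Z.toSubalgebra.toSubmodule := by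
    rw [Submodule.span_le]
    rintro _ ⟨h, rfl⟩
    change E (W G σ h) ∈ Z
    rw [hE]
    -- The eigenvalues sum to q² if `r h = 0` and to 0 otherwise, so by linearity and continuity
    -- only the kernel of `r` survives.
    simp_rw [W_mul_W_mul_star hc r hσ, hs, ← Finset.sum_smul, coe_sum_pow_zmod_mul_add q c hc]
    split_ifs with h0
    · refine SMulMemClass.smul_mem _ (StarSubalgebra.le_topologicalClosure _
        (StarAlgebra.subset_adjoin ℂ _ ⟨h, ?_, rfl⟩))
      exact Prod.ext (neg_eq_zero.mp h0.2) h0.1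
    · rw [zero_smul]
      exact zero_mem _
  exact closure_minimal (s := (Submodule.span ℂ (Set.range (W G σ)) : Set _)) hle
    (hZ.preimage hcont) ((closure_span_W (G := G) (σ := σ)).symm ▸ Set.mem_univ a)

/-- A representation of `C*(G, σ)` is faithful if every character of the subalgebra generated by
the kernel of `r` is induced by it. -/
theorem injective_of_characters (hr : Function.Surjective r) {B : Type*} [CStarAlgebra B]
    (π : twistedGroupCStar G σ →⋆ₐ[ℂ] B)
    (hπ : ∀ φ : (StarAlgebra.adjoin ℂ (W G σ '' {g | r g = 0})).topologicalClosure →⋆ₐ[ℂ] ℂ,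
      ∃ (D : Type) (_ : CStarAlgebra D) (_ : Nontrivial D) (ε : B →⋆ₐ[ℂ] D), ∀ x
        (hx : x ∈ W G σ '' {g | r g = 0}),
        ε (π x) = algebraMap ℂ D (φ ⟨x, StarSubalgebra.le_topologicalClosure _
          (StarAlgebra.subset_adjoin ℂ _ hx)⟩)) :
    Function.Injective π := by
  obtain ⟨s, hs⟩ := hr.hasRightInverse
  have hcom : ∀ x ∈ W G σ '' {g | r g = 0}, ∀ y ∈ W G σ '' {g | r g = 0}, x * y = y * x := by
    rintro _ ⟨g, hg, rfl⟩ _ ⟨h, hh, rfl⟩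
    have hg' : r g = 0 := hg
    have hh' : r h = 0 := hh
    rw [W_mul_W, W_mul_W, hσ, hσ, add_comm, hg', hh']
  have hcom' : ∀ x ∈ W G σ '' {g | r g = 0}, ∀ y ∈ W G σ '' {g | r g = 0},
      x * star y = star y * x := by
    rintro _ ⟨g, hg, rfl⟩ _ ⟨h, hh, rfl⟩
    have hg' : r g = 0 := hg
    rw [star_W, mul_smul_comm, smul_mul_assoc, W_mul_W, W_mul_W, hσ g, hσ _ g, add_comm, hg']
    simp
  rw [injective_iff_map_eq_zero]
  intro a ha
  refine eq_zero_of_sum_unitary_conj_eq_zero (fun x => W G σ (s x)) (fun x => W_mem_unitary _) a ?_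
  -- The averaged `star a * a` lies in the commutative subalgebra, and `π` kills it because each
  -- summand has the factor `π a`.
  refine eq_zero_of_characters_induced hcom hcom' π hπ _
    (sum_conj_mem hc r hσ s hs (star a * a)) ?_
  rw [map_sum]
  refine Finset.sum_eq_zero fun x _ => ?_
  rw [map_mul, map_mul, map_mul, ha, mul_zero, mul_zero, zero_mul]

end Bicharacter

end twistedGroupCStar

/-! ### Powers of roots of unity on the circle -/

theorem pow_zmod_val_natCast {Γ : Type*} [Monoid Γ] {q : ℕ} [NeZero q] {a : Γ} (ha : a ^ q = 1)
    (n : ℕ) : a ^ (n : ZMod q).val = a ^ n := by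
  rw [ZMod.val_natCast, ← pow_eq_pow_mod _ ha]

theorem pow_zmod_val_intCast {Γ : Type*} [Group Γ] {q : ℕ} [NeZero q] {a : Γ} (ha : a ^ q = 1)
    (n : ℤ) : a ^ (n : ZMod q).val = a ^ n := by
  obtain ⟨m, hm⟩ : ∃ m : ℤ, n = ((n : ZMod q).val : ℤ) + q * m := by
    have h : ((n - (n : ZMod q).val : ℤ) : ZMod q) = 0 := by push_cast; simp
    obtain ⟨m, hm⟩ := (ZMod.intCast_zmod_eq_zero_iff_dvd _ _).mp h
    exact ⟨m, by linarith⟩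
  conv_rhs => rw [hm]
  rw [zpow_add, zpow_mul, zpow_natCast, zpow_natCast, ha, one_zpow, mul_one]

theorem orderOf_rootOfUnity (p q : ℕ) [NeZero q] (hpq : p.Coprime q) :
    orderOf (rootOfUnity p q) = q := by
  have h : ((rootOfUnity p q : Circle) : ℂ) = Complex.exp (2 * Real.pi * Complex.I * (p / q)) := by
    rw [rootOfUnity, Circle.coe_exp]
    congr 1
    push_cast
    ring
  have h1 := (Complex.isPrimitiveRoot_exp_of_coprime p q (NeZero.ne q) hpq).eq_orderOf
  rw [← h] at h1
  exact (orderOf_injective Circle.coeHom Circle.coe_injective _).symm.trans h1.symm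

/-! ### The residue of an `N`-adic rational -/

section Residue

variable {N : ℕ} [NeZero N] {q : ℕ} [NeZero q]

theorem NadicRat.eq_div (x : NadicRat N) :
    (x : ℚ) = NadicRat.numerator N x / (N : ℚ) ^ NadicRat.exponent N x :=
  x.2.choose_spec.choose_spec

theorem intCast_mul_pow_eq_of_div_eq {M : ℕ} [NeZero M] {a b : ℤ} {k l : ℕ}
    (h : (a : ℚ) / (M : ℚ) ^ k = b / (M : ℚ) ^ l) : a * (M : ℤ) ^ l = b * (M : ℤ) ^ k := by
  have hM : (M : ℚ) ≠ 0 := by exact_mod_cast NeZero.ne M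
  rw [div_eq_div_iff (pow_ne_zero _ hM) (pow_ne_zero _ hM)] at h
  exact_mod_cast h

/-- The residue `p N⁻ᵏ` modulo `q` of `p / N ^ k`, when `N` is coprime to `q`. -/
def NadicRat.residueFun (N q : ℕ) [NeZero N] (x : NadicRat N) : ZMod q :=
  NadicRat.numerator N x * ((N : ZMod q)⁻¹) ^ NadicRat.exponent N x

-- Cross-multiplying two expressions of `x` and cancelling powers of `N`, invertible modulo `q`,
-- shows that the chosen expression is immaterial.
omit [NeZero q] in
theorem NadicRat.residueFun_eq (hNq : N.Coprime q) (x : NadicRat N) {p : ℤ} {e : ℕ}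
    (hx : (x : ℚ) = p / (N : ℚ) ^ e) :
    NadicRat.residueFun N q x = p * ((N : ZMod q)⁻¹) ^ e := by
  have h := congrArg (Int.cast : ℤ → ZMod q)
    (intCast_mul_pow_eq_of_div_eq ((NadicRat.eq_div x).symm.trans hx))
  push_cast at h
  have hu : (N : ZMod q) * (N : ZMod q)⁻¹ = 1 := ZMod.coe_mul_inv_eq_one N hNq
  have hu' : ∀ n, (N : ZMod q) ^ n * (N : ZMod q)⁻¹ ^ n = 1 := fun n => by
    rw [← mul_pow, hu, one_pow]
  have h1 := hu' e
  have h2 := hu' (NadicRat.exponent N x)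
  unfold NadicRat.residueFun
  generalize (N : ZMod q) ^ e = s at *
  generalize (N : ZMod q)⁻¹ ^ e = s' at *
  generalize (N : ZMod q) ^ NadicRat.exponent N x = t at *
  generalize (N : ZMod q)⁻¹ ^ NadicRat.exponent N x = t' at *
  linear_combination (s' * t') * h - NadicRat.numerator N x * t' * h1 + p * s' * h2

/-- The ring of `N`-adic rationals maps to the integers modulo `q`, when `N` is coprime to `q`. -/
def NadicRat.residue (hNq : N.Coprime q) : NadicRat N →+ ZMod q :=
  AddMonoidHom.mk' (NadicRat.residueFun N q) fun x y => by
    have hN : (N : ℚ) ≠ 0 := by exact_mod_cast NeZero.ne N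
    have hu : (N : ZMod q) * (N : ZMod q)⁻¹ = 1 := ZMod.coe_mul_inv_eq_one N hNq
    have hu' : ∀ n, (N : ZMod q) ^ n * (N : ZMod q)⁻¹ ^ n = 1 := fun n => by
      rw [← mul_pow, hu, one_pow]
    have hx := NadicRat.eq_div x
    have hy := NadicRat.eq_div y
    have hxy : ((x + y : NadicRat N) : ℚ) =
        ((NadicRat.numerator N x * N ^ NadicRat.exponent N y +
          NadicRat.numerator N y * N ^ NadicRat.exponent N x : ℤ) : ℚ) /
          (N : ℚ) ^ (NadicRat.exponent N x + NadicRat.exponent N y) := by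
      rw [AddSubgroup.coe_add, hx, hy, pow_add]
      push_cast
      field_simp
    rw [NadicRat.residueFun_eq hNq _ hxy]
    unfold NadicRat.residueFun
    have h1 := hu' (NadicRat.exponent N x)
    have h2 := hu' (NadicRat.exponent N y)
    push_cast
    rw [pow_add]
    linear_combination (NadicRat.numerator N x : ZMod q) * (N : ZMod q)⁻¹ ^ NadicRat.exponent N x * h2
      + (NadicRat.numerator N y : ZMod q) * (N : ZMod q)⁻¹ ^ NadicRat.exponent N y * h1

omit [NeZero q] in
theorem NadicRat.residue_eq (hNq : N.Coprime q) (x : NadicRat N) {p : ℤ} {e : ℕ}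
    (hx : (x : ℚ) = p / (N : ℚ) ^ e) : NadicRat.residue hNq x = p * ((N : ZMod q)⁻¹) ^ e :=
  NadicRat.residueFun_eq hNq x hx

/-- An integer over a power of `N`, as an `N`-adic rational. -/
def NadicRat.mk (N : ℕ) [NeZero N] (p : ℤ) (e : ℕ) : NadicRat N := ⟨p / (N : ℚ) ^ e, p, e, rfl⟩

theorem NadicRat.residue_surjective (hNq : N.Coprime q) :
    Function.Surjective (NadicRat.residue hNq) := fun a =>
  ⟨NadicRat.mk N a.val 0, by
    rw [NadicRat.residue_eq hNq (NadicRat.mk N a.val 0) (p := a.val) (e := 0) rfl]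
    simp⟩

end Residue

/-! ### Periodic multipliers -/

section Periodic

variable {N : ℕ} [NeZero N] {α : ℕ → ℝ} (hα : α ∈ Xi N) {q : ℕ} [NeZero q] (hNq : N.Coprime q)

include hα hNq

-- The numbers e_n = exp(2πi α_n) satisfy e_(n+1)^N = e_n and start at c. Once they are known to be
-- q-th roots of unity, taking N-th roots among them is uniquely possible, since N is invertible
-- modulo q.
omit [NeZero N] in
theorem circleExp_eq_pow_of_periodic (hper : ∃ j : ℕ, 0 < j ∧ ∀ n, α (n + j) = α n) {c : Circle}
    (hc : c ^ q = 1) (h0 : Circle.exp (2 * Real.pi * α 0) = c) (n : ℕ) :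
    Circle.exp (2 * Real.pi * α n) = c ^ (((N : ZMod q)⁻¹) ^ n).val := by
  set e : ℕ → Circle := fun n => Circle.exp (2 * Real.pi * α n) with he
  have hstep : ∀ n, e (n + 1) ^ N = e n := by
    intro n
    obtain ⟨k, -, hk⟩ := hα.2 n
    have h1 : (N : ℝ) * (2 * Real.pi * α (n + 1)) = 2 * Real.pi * α n + 2 * Real.pi * (k : ℤ) := by
      push_cast
      linear_combination 2 * Real.pi * hk
    simp only [he]
    rw [← Circle.exp_natCast_mul, h1, Circle.exp_add, Circle.exp_two_pi_mul_int, mul_one]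
  have hsteps : ∀ m n, e (n + m) ^ N ^ m = e n := by
    intro m
    induction m with
    | zero => intro n; simp
    | succ m ih => intro n; rw [pow_succ', pow_mul, ← add_assoc, hstep, ih]
  obtain ⟨j, hj, hper⟩ := hper
  have hpers : ∀ m n, e (n + j * m) = e n := by
    intro m
    induction m with
    | zero => intro n; simp
    | succ m ih =>
      intro n
      rw [mul_add, mul_one, ← add_assoc]
      simp only [he, hper] at ih ⊢
      exact ih n
  -- Raising e_n^q to the power N^n gives c^q = 1, while by periodicity raising it to N^(jn) gives
  -- it back. As jn ≥ n, the second power factors through the first.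
  have hord : e n ^ q = 1 := by
    have h1 : (e n ^ q) ^ N ^ n = 1 := by
      have := hsteps n 0
      rw [zero_add] at this
      rw [← pow_mul, mul_comm, pow_mul, this]
      exact (congrArg (· ^ q) h0).trans hc
    have h2 : (e n ^ q) ^ N ^ (j * n) = e n ^ q := by
      have := hsteps (j * n) n
      rw [hpers] at this
      rw [← pow_mul, mul_comm, pow_mul, this]
    rw [← h2, ← Nat.sub_add_cancel (Nat.le_mul_of_pos_left n hj), pow_add, mul_comm, pow_mul, h1,
      one_pow]
  have hc' : c = e n ^ N ^ n := by
    have := hsteps n 0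
    rw [zero_add] at this
    rw [this]
    exact h0.symm
  change e n = _
  rw [hc', ← pow_mul, ← pow_zmod_val_natCast hord]
  push_cast
  rw [ZMod.natCast_zmod_val, ← mul_pow, ZMod.coe_mul_inv_eq_one N hNq, one_pow,
    ← Nat.cast_one (R := ZMod q), pow_zmod_val_natCast hord, pow_one]

/-- For a periodic sequence the multiplier is the pullback of a bicharacter of `ℤ / q ℤ`. -/
theorem solenoidMultiplier_eq_pow (hper : ∃ j : ℕ, 0 < j ∧ ∀ n, α (n + j) = α n) {c : Circle}
    (hc : c ^ q = 1) (h0 : Circle.exp (2 * Real.pi * α 0) = c) (x y : NadicRat N × NadicRat N) :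
    solenoidMultiplier N α x y =
      c ^ (NadicRat.residue hNq x.1 * NadicRat.residue hNq y.2).val := by
  rw [NadicRat.residue_eq hNq _ (NadicRat.eq_div x.1), NadicRat.residue_eq hNq _ (NadicRat.eq_div y.2)]
  unfold solenoidMultiplier
  generalize NadicRat.numerator N x.1 = a
  generalize NadicRat.numerator N y.2 = b
  generalize NadicRat.exponent N x.1 = m
  generalize NadicRat.exponent N y.2 = n
  have h1 : 2 * Real.pi * (α (m + n) * a * b) = ((a * b : ℤ) : ℝ) * (2 * Real.pi * α (m + n)) := by
    push_cast
    ring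
  have h2 : (a * (N : ZMod q)⁻¹ ^ m * (b * (N : ZMod q)⁻¹ ^ n) : ZMod q) =
      (((a * b) * (((N : ZMod q)⁻¹ ^ (m + n)).val : ℤ) : ℤ) : ZMod q) := by
    push_cast
    rw [ZMod.natCast_zmod_val]
    ring
  rw [h1, Circle.exp_intCast_mul, circleExp_eq_pow_of_periodic hα hNq hper hc h0, h2,
    pow_zmod_val_intCast hc, mul_comm (a * b), zpow_mul _ _ (a * b), zpow_natCast]

end Periodic

/-! ### Characters of the `N`-adic rationals -/

section SolenoidChar

theorem Solenoid.apply_add_pow {M : ℕ} (z : Solenoid M) (n m : ℕ) : z.1 (n + m) ^ M ^ m = z.1 n := by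
  induction m with
  | zero => simp
  | succ m ih => rw [pow_succ', pow_mul, ← add_assoc, z.2, ih]

variable {N : ℕ} [NeZero N] {k : ℕ}

/-- The character of the `N`-adic rationals given by a point of the `N ^ k`-solenoid. -/
def solenoidChar (x : NadicRat N) (z : Solenoid (N ^ k)) : Circle :=
  z.1 (NadicRat.exponent N x) ^
    (NadicRat.numerator N x * N ^ ((k - 1) * NadicRat.exponent N x) : ℤ)

/-- For k > 0, p/N^e = p N^((k-1)e) / (N^k)^e, which accounts for the exponent and the coordinate in
`solenoidChar`. -/
theorem NadicRat.exists_eq_div (hk : 0 < k) (x : NadicRat N) :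
    ∃ (a : ℤ) (n : ℕ), (x : ℚ) = a / ((N ^ k : ℕ) : ℚ) ^ n := by
  refine ⟨NadicRat.numerator N x * N ^ ((k - 1) * NadicRat.exponent N x), NadicRat.exponent N x, ?_⟩
  obtain ⟨l, rfl⟩ := Nat.exists_eq_succ_of_ne_zero hk.ne'
  have hN : (N : ℚ) ≠ 0 := by exact_mod_cast NeZero.ne N
  conv_lhs => rw [NadicRat.eq_div x]
  rw [Nat.succ_eq_add_one, Nat.add_sub_cancel]
  push_cast
  rw [← pow_mul, add_mul, one_mul, pow_add]
  field_simp

theorem solenoidChar_eq (hk : 0 < k) (x : NadicRat N) (z : Solenoid (N ^ k)) {a : ℤ} {n : ℕ}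
    (hx : (x : ℚ) = a / ((N ^ k : ℕ) : ℚ) ^ n) : solenoidChar x z = z.1 n ^ a := by
  have hN : (N : ℚ) ≠ 0 := by exact_mod_cast NeZero.ne N
  have hx' : (x : ℚ) = ((NadicRat.numerator N x * N ^ ((k - 1) * NadicRat.exponent N x) : ℤ) : ℚ) /
      ((N ^ k : ℕ) : ℚ) ^ NadicRat.exponent N x := by
    obtain ⟨l, rfl⟩ := Nat.exists_eq_succ_of_ne_zero hk.ne'
    conv_lhs => rw [NadicRat.eq_div x]
    rw [Nat.succ_eq_add_one, Nat.add_sub_cancel]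
    push_cast
    rw [← pow_mul, add_mul, one_mul, pow_add]
    field_simp
  have h := intCast_mul_pow_eq_of_div_eq (hx'.symm.trans hx)
  unfold solenoidChar
  generalize (NadicRat.numerator N x * N ^ ((k - 1) * NadicRat.exponent N x) : ℤ) = b at *
  generalize NadicRat.exponent N x = m at *
  have h1 := Solenoid.apply_add_pow z n m
  have h2 := Solenoid.apply_add_pow z m n
  rw [← h1, ← h2, add_comm m n, ← zpow_natCast, ← zpow_natCast, ← zpow_mul, ← zpow_mul]
  congr 1
  push_cast at h ⊢
  linear_combination h

theorem solenoidChar_add (hk : 0 < k) (x y : NadicRat N) (z : Solenoid (N ^ k)) :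
    solenoidChar (x + y) z = solenoidChar x z * solenoidChar y z := by
  have hN : (N : ℚ) ≠ 0 := by exact_mod_cast NeZero.ne N
  obtain ⟨a, n, hx⟩ := NadicRat.exists_eq_div hk x
  obtain ⟨b, m, hy⟩ := NadicRat.exists_eq_div hk y
  have hxy : ((x + y : NadicRat N) : ℚ) =
      ((a * ((N ^ k : ℕ) : ℤ) ^ m + b * ((N ^ k : ℕ) : ℤ) ^ n : ℤ) : ℚ) /
        ((N ^ k : ℕ) : ℚ) ^ (n + m) := by
    rw [AddSubgroup.coe_add, hx, hy, pow_add]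
    push_cast
    field_simp
  rw [solenoidChar_eq hk _ z hx, solenoidChar_eq hk _ z hy, solenoidChar_eq hk _ z hxy, zpow_add,
    mul_comm a, mul_comm b, zpow_mul, zpow_mul, ← Solenoid.apply_add_pow z n m, ← Solenoid.apply_add_pow z m n,
    add_comm m n]
  norm_cast

theorem solenoidChar_mul (x : NadicRat N) (z w : Solenoid (N ^ k)) :
    solenoidChar x (z * w) = solenoidChar x z * solenoidChar x w :=
  mul_zpow _ _ _

@[fun_prop]
theorem continuous_solenoidChar (x : NadicRat N) :
    Continuous (solenoidChar (k := k) x) := by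
  unfold solenoidChar
  exact ((continuous_apply _).comp continuous_subtype_val).zpow _

/-- With denominators (N^k)^n the residue of a fraction is just its numerator, as N^k ≡ 1 modulo q.
Thus translation by constants on the solenoid is dual to the residue map. -/
theorem solenoidChar_const (hk : 0 < k) {q : ℕ} [NeZero q] (hNq : N.Coprime q)
    (hkq : ((N ^ k : ℕ) : ZMod q) = 1) {c : Circle} (hc : c ^ q = 1) (hcM : c ^ (N ^ k) = c)
    (x : NadicRat N) :
    solenoidChar x (Solenoid.const c hcM) = c ^ (NadicRat.residue hNq x).val := by
  obtain ⟨a, n, hx⟩ := NadicRat.exists_eq_div hk x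
  have hx' : (x : ℚ) = a / (N : ℚ) ^ (k * n) := by
    rw [hx]
    push_cast
    rw [pow_mul]
  have h1 : ((N : ZMod q)⁻¹) ^ (k * n) = 1 := by
    have h2 : (N : ZMod q) ^ (k * n) * ((N : ZMod q)⁻¹) ^ (k * n) = 1 := by
      rw [← mul_pow, ZMod.coe_mul_inv_eq_one N hNq, one_pow]
    push_cast at hkq
    rwa [pow_mul (N : ZMod q), hkq, one_pow, one_mul] at h2
  rw [solenoidChar_eq hk _ _ hx, NadicRat.residue_eq hNq x hx', h1, mul_one,
    pow_zmod_val_intCast hc]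
  rfl

end SolenoidChar

/-! ### Roots in solenoid groups -/

section Roots

/-- The sequence starting at `z₀` whose successive quotients are the powers `s (n + 1) ^ (-t)`. -/
def solenoidLift (t : ℕ) (s : ℕ → Circle) (z₀ : Circle) : ℕ → Circle
  | 0 => z₀
  | n + 1 => solenoidLift t s z₀ n * (s (n + 1) ^ t)⁻¹

/-- The recursion is forced: a solenoid point z with z^q = s has z_n = z_(n+1)^(1+qt) = z_(n+1)
s_(n+1)^t. Conversely s_n = s_(n+1)^(1+qt) makes the recursion preserve z_n^q = s_n. -/
theorem solenoidLift_pow {M q t : ℕ} (hM : M = 1 + q * t) {s : ℕ → Circle}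
    (hs : ∀ n, s (n + 1) ^ M = s n) {z₀ : Circle} (hz : z₀ ^ q = s 0) (n : ℕ) :
    solenoidLift t s z₀ n ^ q = s n := by
  induction n with
  | zero => exact hz
  | succ n ih =>
    rw [solenoidLift, mul_pow, ih, ← hs n, hM, pow_add, pow_one, inv_pow, ← pow_mul, mul_comm q t,
      mul_inv_cancel_right]

theorem solenoidLift_mem {M q t : ℕ} (hM : M = 1 + q * t) {s : ℕ → Circle}
    (hs : ∀ n, s (n + 1) ^ M = s n) {z₀ : Circle} (hz : z₀ ^ q = s 0) :
    solenoidLift t s z₀ ∈ Solenoid M := by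
  intro n
  have h := solenoidLift_pow hM hs hz n
  rw [solenoidLift, mul_pow, inv_pow, ← pow_mul, mul_comm t M, pow_mul, hs]
  conv_lhs => rw [hM]
  rw [pow_add, pow_one, pow_mul, h, mul_inv_cancel_right]

theorem Circle.exists_pow_eq (q : ℕ) [NeZero q] (c : Circle) : ∃ z : Circle, z ^ q = c := by
  have hq : (q : ℝ) ≠ 0 := by exact_mod_cast NeZero.ne q
  refine ⟨Circle.exp ((c : ℂ).arg / q), ?_⟩
  rw [← Circle.exp_natCast_mul, mul_div_cancel₀ _ hq, Circle.exp_arg]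

/-- Every character of the `N`-adic rationals of residue `0` is given by a point of the
solenoid. -/
theorem exists_solenoidChar_eq {N : ℕ} [NeZero N] {k : ℕ} (hk : 0 < k) {q : ℕ} [NeZero q]
    (hNq : N.Coprime q) {t : ℕ} (ht : N ^ k = 1 + q * t) (f : NadicRat N → Circle)
    (hf : ∀ x y, NadicRat.residue hNq x = 0 → NadicRat.residue hNq y = 0 → f (x + y) = f x * f y) :
    ∃ z : Solenoid (N ^ k), ∀ x, NadicRat.residue hNq x = 0 → f x = solenoidChar x z := by
  have hN : (N : ℚ) ≠ 0 := by exact_mod_cast NeZero.ne N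
  have hkq : (N : ZMod q) ^ k = 1 := by
    have := congrArg (Nat.cast : ℕ → ZMod q) ht
    push_cast at this
    rw [this]
    simp
  have hinv : ∀ n, ((N : ZMod q)⁻¹) ^ (k * n) = 1 := fun n => by
    have h2 : (N : ZMod q) ^ (k * n) * ((N : ZMod q)⁻¹) ^ (k * n) = 1 := by
      rw [← mul_pow, ZMod.coe_mul_inv_eq_one N hNq, one_pow]
    rwa [pow_mul (N : ZMod q), hkq, one_pow, one_mul] at h2
  let F : (NadicRat.residue (N := N) hNq).ker →+ Additive Circle :=
    AddMonoidHom.mk' (fun x => Additive.ofMul (f x)) fun x y => hf x y x.2 y.2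
  have hg : ∀ n, NadicRat.residue hNq (NadicRat.mk N q (k * n)) = 0 := fun n => by
    rw [NadicRat.residue_eq hNq _ (p := q) (e := k * n) rfl]
    simp
  -- The fractions q/N^(kn) generate the kernel of the residue map. The values of f on them form a
  -- solenoid point s, and the required z is a q-th root of s.
  let g : ℕ → (NadicRat.residue (N := N) hNq).ker := fun n => ⟨NadicRat.mk N q (k * n), hg n⟩
  let s : ℕ → Circle := fun n => (F (g n)).toMul
  have hzs : ∀ (b : ℤ) (x : (NadicRat.residue (N := N) hNq).ker), F (b • x) = b • F x :=
    fun b x => map_zsmul F b x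
  have hs : ∀ n, s (n + 1) ^ (N ^ k) = s n := by
    intro n
    have h1 : g n = (N ^ k) • g (n + 1) := by
      ext
      change (q : ℤ) / (N : ℚ) ^ (k * n) = _
      rw [AddSubgroup.coe_nsmul, AddSubgroup.coe_nsmul]
      change _ = (N ^ k) • (((q : ℤ) : ℚ) / (N : ℚ) ^ (k * (n + 1)))
      rw [nsmul_eq_mul, mul_add, mul_one, pow_add]
      push_cast
      field_simp
    simp only [s]
    rw [h1, map_nsmul]
    rfl
  -- Any root of the first coordinate will do; the recursion determines the others.
  obtain ⟨z₀, hz₀⟩ := Circle.exists_pow_eq q (s 0)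
  refine ⟨⟨solenoidLift t s z₀, solenoidLift_mem ht hs hz₀⟩, fun x hx => ?_⟩
  obtain ⟨a, n, hxa⟩ := NadicRat.exists_eq_div hk x
  have hx' : (x : ℚ) = a / (N : ℚ) ^ (k * n) := by
    rw [hxa]
    push_cast
    rw [pow_mul]
  rw [solenoidChar_eq hk _ _ hxa]
  -- Residue 0 now says q ∣ a, so x is an integer multiple of the generator q/N^(kn).
  rw [NadicRat.residue_eq hNq x hx', hinv, mul_one] at hx
  obtain ⟨b, rfl⟩ := (ZMod.intCast_zmod_eq_zero_iff_dvd _ _).mp hx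
  have h1 : x = ((b • g n : (NadicRat.residue (N := N) hNq).ker) : NadicRat N) := by
    ext
    rw [hx', AddSubgroup.coe_zsmul, AddSubgroup.coe_zsmul]
    change _ = b • (((q : ℤ) : ℚ) / (N : ℚ) ^ (k * n))
    rw [zsmul_eq_mul]
    push_cast
    ring
  have h2 : f x = s n ^ b := by
    rw [h1]
    change (F (b • g n)).toMul = _
    rw [hzs]
    rfl
  rw [h2, zpow_mul, zpow_natCast]
  exact congrArg (· ^ b) (solenoidLift_pow ht hs hz₀ n).symm

end Roots

/-! ### Clock and shift matrices -/

section Weyl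

variable {q : ℕ} [NeZero q] {c : Circle} (hc : c ^ q = 1)

/-- The product `uᵃ vᵇ` of powers of the clock and shift matrices. -/
def weyl (c : Circle) (a b : ZMod q) : unitary (MatAlg q) := clock q c ^ a.val * shift q ^ b.val

theorem shift_pow_card : shift q ^ q = 1 := by
  ext1
  exact (map_pow (CStarMatrix.ofMatrixStarAlgEquiv (n := Fin q) (A := ℂ))
    (shiftMatrix q) q).symm.trans (by rw [shiftMatrix_pow q, map_one]; rfl)

theorem conjAut_eq_weyl (n m : ZMod q) (a : MatAlg q) :
    conjAut q c n m a = (((weyl c n m)⁻¹ : unitary (MatAlg q)) : MatAlg q) * a * weyl c n m := by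
  rw [conjAut, Unitary.conjStarAlgAut_apply, ← Unitary.coe_star, Unitary.star_eq_inv, inv_inv]
  rfl

include hc

omit [NeZero q] in
theorem clock_pow_card : clock q c ^ q = 1 := by
  ext1
  exact (map_pow (CStarMatrix.ofMatrixStarAlgEquiv (n := Fin q) (A := ℂ))
    (clockMatrix q c) q).symm.trans (by rw [clockMatrix_pow q c hc, map_one]; rfl)

theorem clock_mul_shift : (clock q c : MatAlg q) * (shift q : MatAlg q) =
    (c : ℂ) • ((shift q : MatAlg q) * (clock q c : MatAlg q)) :=
  congrArg CStarMatrix.ofMatrix (clockMatrix_mul_shiftMatrix q c hc)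

theorem clock_pow_mul_shift_pow (a b : ℕ) :
    (clock q c : MatAlg q) ^ a * (shift q : MatAlg q) ^ b =
      ((c ^ (a * b) : Circle) : ℂ) • ((shift q : MatAlg q) ^ b * (clock q c : MatAlg q) ^ a) := by
  have h1 : ∀ a : ℕ, (clock q c : MatAlg q) ^ a * (shift q : MatAlg q) =
      ((c ^ a : Circle) : ℂ) • ((shift q : MatAlg q) * (clock q c : MatAlg q) ^ a) := by
    intro a
    induction a with
    | zero => simp
    | succ a ih =>
      rw [pow_succ, mul_assoc, clock_mul_shift hc, mul_smul_comm, ← mul_assoc, ih, smul_mul_assoc,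
        smul_smul, mul_assoc, ← pow_succ, ← Circle.coe_mul, ← pow_succ']
  induction b with
  | zero => simp
  | succ b ih =>
    rw [pow_succ, ← mul_assoc, ih, smul_mul_assoc, mul_assoc, h1, mul_smul_comm, smul_smul,
      ← mul_assoc, ← Circle.coe_mul, ← pow_add, mul_add, mul_one]

theorem shift_pow_mul_clock_pow (a b : ZMod q) :
    (shift q : MatAlg q) ^ b.val * (clock q c : MatAlg q) ^ a.val =
      ((c ^ (-(b * a)).val : Circle) : ℂ) •
        ((clock q c : MatAlg q) ^ a.val * (shift q : MatAlg q) ^ b.val) := by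
  have h : c ^ (-(b * a)).val * c ^ (a.val * b.val) = 1 := by
    rw [← pow_zmod_val_natCast hc (a.val * b.val), ← pow_zmod_val_add q c hc]
    push_cast
    rw [ZMod.natCast_zmod_val, ZMod.natCast_zmod_val, mul_comm, neg_add_cancel, ZMod.val_zero,
      pow_zero]
  rw [clock_pow_mul_shift_pow hc, smul_smul, ← Circle.coe_mul, h, Circle.coe_one, one_smul]

theorem weyl_mul_weyl (a b a' b' : ZMod q) :
    (weyl c a b : MatAlg q) * (weyl c a' b' : MatAlg q) =
      ((c ^ (-(b * a')).val : Circle) : ℂ) • (weyl c (a + a') (b + b') : MatAlg q) := by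
  simp only [weyl, pow_zmod_val_add q _ (clock_pow_card hc), pow_zmod_val_add q _ shift_pow_card,
    Submonoid.coe_mul, SubmonoidClass.coe_pow]
  calc _ = (clock q c : MatAlg q) ^ a.val *
        ((shift q : MatAlg q) ^ b.val * (clock q c : MatAlg q) ^ a'.val) *
          (shift q : MatAlg q) ^ b'.val := by simp only [mul_assoc]
    _ = _ := by
      rw [shift_pow_mul_clock_pow hc]
      simp only [mul_smul_comm, smul_mul_assoc, mul_assoc]

/-- Multiplying two Weyl products in either order gives the same Weyl product up to powers of c; the
ratio of these is the eigenvalue. -/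
theorem conjAut_weyl (n m a b : ZMod q) :
    conjAut q c n m (weyl c a b : MatAlg q) =
      ((c ^ (m * a - n * b).val : Circle) : ℂ) • (weyl c a b : MatAlg q) := by
  have h : (weyl c a b : MatAlg q) * weyl c n m =
      ((c ^ (m * a - n * b).val : Circle) : ℂ) • ((weyl c n m : MatAlg q) * weyl c a b) := by
    rw [weyl_mul_weyl hc, weyl_mul_weyl hc, smul_smul, ← Circle.coe_mul, add_comm a, add_comm b,
      ← pow_zmod_val_add q c hc]
    congr 4
    ring
  rw [conjAut_eq_weyl, mul_assoc, h, mul_smul_comm, ← mul_assoc, ← Submonoid.coe_mul,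
    inv_mul_cancel, OneMemClass.coe_one, one_mul]

omit hc in
theorem weyl_zero : weyl c (0 : ZMod q) 0 = 1 := by
  simp [weyl]

omit hc in
theorem shiftMatrix_pow_apply (n : ℕ) (i j : Fin q) :
    (shiftMatrix q ^ n) i j = if i = j + Fin.ofNat q n then 1 else 0 := by
  induction n generalizing i j with
  | zero => simp [Matrix.one_apply]
  | succ n ih =>
    have h1 : Fin.ofNat q (n + 1) = 1 + Fin.ofNat q n := by
      ext
      simp [Fin.val_add, add_comm]
    rw [pow_succ, Matrix.mul_apply]
    simp_rw [ih, h1]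
    simp [shiftMatrix, add_comm, add_left_comm]

omit hc in
/-- The products of powers of the clock and shift matrices span the matrices. -/
theorem span_weyl (hc : orderOf c = q) (K : Submodule ℂ (MatAlg q))
    (hK : ∀ a b : ZMod q, (weyl c a b : MatAlg q) ∈ K) (T : MatAlg q) : T ∈ K := by
  have hq : c ^ q = 1 := hc ▸ pow_orderOf_eq_one c
  have hq0 : (q : ℂ) ≠ 0 := by exact_mod_cast NeZero.ne q
  let L : Submodule ℂ (Matrix (Fin q) (Fin q) ℂ) :=
    K.comap (CStarMatrix.ofMatrixₗ (m := Fin q) (n := Fin q) (A := ℂ) (R := ℂ)).toLinearMap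
  have hL : ∀ (a : ZMod q) (b : Fin q), clockMatrix q c ^ a.val * shiftMatrix q ^ (b : ℕ) ∈ L := by
    intro a b
    have h1 : (b : ℕ) = ((b : ℕ) : ZMod q).val := by
      rw [ZMod.val_natCast, Nat.mod_eq_of_lt b.2]
    rw [h1]
    have h2 : CStarMatrix.ofMatrixStarAlgEquiv (clockMatrix q c ^ a.val *
        shiftMatrix q ^ ((b : ℕ) : ZMod q).val) = (weyl c a ((b : ℕ) : ZMod q) : MatAlg q) := by
      rw [map_mul, map_pow, map_pow]
      rfl
    exact (congrArg (· ∈ K) h2).mpr (hK a ((b : ℕ) : ZMod q))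
  have hsingle : ∀ i j : Fin q, Matrix.single i j (1 : ℂ) ∈ L := by
    intro i j
    -- Fourier inversion: averaging c^(-ai) u^a over a gives the projection onto e_i, and v^(i-j)
    -- carries e_j to e_i.
    have h1 : Matrix.single i j (1 : ℂ) = (q : ℂ)⁻¹ • ∑ a : ZMod q,
        ((c ^ (a * -((i : ℕ) : ZMod q)).val : Circle) : ℂ) •
          (clockMatrix q c ^ a.val * shiftMatrix q ^ ((i - j : Fin q) : ℕ)) := by
      ext k l
      have h2 : ∀ a : ZMod q, ((c ^ (a * -((i : ℕ) : ZMod q)).val : Circle) : ℂ) *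
          (c : ℂ) ^ ((k : ℕ) * a.val) =
            ((c ^ (a * (((k : ℕ) : ZMod q) - ((i : ℕ) : ZMod q))).val : Circle) : ℂ) := by
        intro a
        rw [← Circle.coe_pow, ← Circle.coe_mul, ← pow_zmod_val_natCast hq ((k : ℕ) * a.val),
          ← pow_zmod_val_add q c hq]
        push_cast
        rw [ZMod.natCast_zmod_val]
        congr 3
        ring
      have h3 : (((k : ℕ) : ZMod q) - ((i : ℕ) : ZMod q) = 0) ↔ i = k := by
        rw [sub_eq_zero, ZMod.natCast_eq_natCast_iff', Nat.mod_eq_of_lt k.2, Nat.mod_eq_of_lt i.2]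
        exact ⟨fun h => Fin.ext h.symm, fun h => h ▸ rfl⟩
      have h4 : k = l + (i - j) ↔ l = k - i + j := by
        constructor <;> rintro rfl <;> abel
      rw [Matrix.smul_apply, Matrix.sum_apply]
      simp only [Matrix.smul_apply, clockMatrix, Matrix.diagonal_pow, Matrix.diagonal_mul,
        Pi.pow_apply, shiftMatrix_pow_apply, smul_eq_mul, ← pow_mul, ← mul_assoc, h2]
      rw [← Finset.sum_mul, coe_sum_pow_zmod_mul q c hc]
      simp only [h3, Fin.ofNat_val_eq_self, h4, Matrix.single_apply]
      by_cases hik : i = k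
      · subst hik
        simp [hq0, eq_comm]
      · simp [hik]
    rw [h1]
    exact L.smul_mem _ (L.sum_mem fun a _ => L.smul_mem _ (hL a _))
  have hT : (CStarMatrix.ofMatrixStarAlgEquiv (n := Fin q) (A := ℂ)).symm T ∈ L := by
    rw [Matrix.matrix_eq_sum_single ((CStarMatrix.ofMatrixStarAlgEquiv (n := Fin q) (A := ℂ)).symm T)]
    refine L.sum_mem fun i _ => L.sum_mem fun j _ => ?_
    have := L.smul_mem ((CStarMatrix.ofMatrixStarAlgEquiv (n := Fin q) (A := ℂ)).symm T i j)
      (hsingle i j)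
    rwa [Matrix.smul_single, smul_eq_mul, mul_one] at this
  change (CStarMatrix.ofMatrixStarAlgEquiv (n := Fin q) (A := ℂ))
    ((CStarMatrix.ofMatrixStarAlgEquiv (n := Fin q) (A := ℂ)).symm T) ∈ K at hT
  rwa [StarAlgEquiv.apply_symm_apply] at hT

end Weyl

/-! ### Density of the characters of the solenoid -/

section Density

variable {N : ℕ} [NeZero N] {k : ℕ}

/-- The function on the square of the solenoid given by a pair of `N`-adic rationals. -/
def solenoidCharMap (k : ℕ) (g : NadicRat N × NadicRat N) :
    C(Solenoid (N ^ k) × Solenoid (N ^ k), ℂ) where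
  toFun z := (solenoidChar g.1 z.1 * solenoidChar g.2 z.2 : Circle)
  continuous_toFun := continuous_induced_dom.comp
    (((continuous_solenoidChar g.1).comp continuous_fst).mul
      ((continuous_solenoidChar g.2).comp continuous_snd))

theorem solenoidCharMap_mul (hk : 0 < k) (g h : NadicRat N × NadicRat N) :
    solenoidCharMap k g * solenoidCharMap k h = solenoidCharMap k (g + h) := by
  ext z
  simp only [solenoidCharMap, ContinuousMap.mul_apply, ContinuousMap.coe_mk, Prod.fst_add,
    Prod.snd_add, solenoidChar_add hk, Circle.coe_mul]
  ring

theorem solenoidChar_zero (hk : 0 < k) (z : Solenoid (N ^ k)) : solenoidChar 0 z = 1 := by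
  rw [solenoidChar_eq hk 0 z (a := 0) (n := 0) (by simp), zpow_zero]

theorem solenoidCharMap_zero (hk : 0 < k) : solenoidCharMap k (0 : NadicRat N × NadicRat N) = 1 := by
  ext z
  simp [solenoidCharMap, solenoidChar_zero hk]

theorem star_solenoidCharMap (hk : 0 < k) (g : NadicRat N × NadicRat N) :
    star (solenoidCharMap k g) = solenoidCharMap k (-g) := by
  have hneg : ∀ (x : NadicRat N) (z : Solenoid (N ^ k)),
      solenoidChar (-x) z = (solenoidChar x z)⁻¹ := fun x z =>
    eq_inv_of_mul_eq_one_left (by rw [← solenoidChar_add hk, neg_add_cancel, solenoidChar_zero hk])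
  ext z
  simp only [solenoidCharMap, ContinuousMap.star_apply, ContinuousMap.coe_mk, Prod.fst_neg,
    Prod.snd_neg, hneg, ← mul_inv, Circle.coe_inv_eq_conj]
  rfl

/-- Stone–Weierstrass: the span is a unital star-subalgebra, and it separates points because the
character of 1/N^(kn) is the n-th coordinate. -/
theorem closure_span_solenoidCharMap (hk : 0 < k) :
    closure (Submodule.span ℂ (Set.range (solenoidCharMap (N := N) k)) :
      Set C(Solenoid (N ^ k) × Solenoid (N ^ k), ℂ)) = Set.univ := by
  set K := Submodule.span ℂ (Set.range (solenoidCharMap (N := N) k))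
  have hW : ∀ g, solenoidCharMap k g ∈ K := fun g => Submodule.subset_span ⟨g, rfl⟩
  let D : StarSubalgebra ℂ C(Solenoid (N ^ k) × Solenoid (N ^ k), ℂ) :=
    { carrier := K
      mul_mem' := by
        intro x y hx hy
        have hK : K * K ≤ K := by
          rw [Submodule.span_mul_span, Submodule.span_le]
          rintro _ ⟨_, ⟨g, rfl⟩, _, ⟨h, rfl⟩, rfl⟩
          change solenoidCharMap k g * solenoidCharMap k h ∈ K
          rw [solenoidCharMap_mul hk]
          exact hW _
        exact hK (Submodule.mul_mem_mul hx hy)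
      add_mem' := K.add_mem
      algebraMap_mem' := fun r => by
        rw [Algebra.algebraMap_eq_smul_one, ← solenoidCharMap_zero hk]
        exact K.smul_mem _ (hW _)
      star_mem' := by
        intro x hx
        change star x ∈ K
        replace hx : x ∈ K := hx
        induction hx using Submodule.span_induction with
        | mem x hx =>
          obtain ⟨g, rfl⟩ := hx
          rw [star_solenoidCharMap hk]
          exact hW _
        | zero => rw [star_zero]; exact K.zero_mem
        | add x y _ _ hx hy => rw [star_add]; exact K.add_mem hx hy
        | smul c x _ hx => rw [star_smul]; exact K.smul_mem _ hx }
  have hsep : D.SeparatesPoints := by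
    have hmk : ∀ (n : ℕ) (z : Solenoid (N ^ k)), solenoidChar (NadicRat.mk N 1 (k * n)) z = z.1 n := by
      intro n z
      rw [solenoidChar_eq hk (NadicRat.mk N 1 (k * n)) z (a := 1) (n := n), zpow_one]
      change ((1 : ℤ) : ℚ) / (N : ℚ) ^ (k * n) = _
      push_cast
      rw [pow_mul]
    intro z w hzw
    by_contra! h
    have h' : ∀ g, solenoidCharMap k g z = solenoidCharMap (N := N) k g w := fun g =>
      h _ ⟨_, hW g, rfl⟩
    refine hzw (Prod.ext (Subtype.ext (funext fun n => ?_)) (Subtype.ext (funext fun n => ?_)))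
    · have := h' (NadicRat.mk N 1 (k * n), 0)
      exact Circle.ext (by simpa [solenoidCharMap, solenoidChar_zero hk, hmk] using this)
    · have := h' (0, NadicRat.mk N 1 (k * n))
      exact Circle.ext (by simpa [solenoidCharMap, solenoidChar_zero hk, hmk] using this)
  have := ContinuousMap.starSubalgebra_topologicalClosure_eq_top_of_separatesPoints D hsep
  exact congrArg (SetLike.coe : StarSubalgebra ℂ _ → Set _) this

end Density

/-! ### Faithfulness in terms of characters of the kernel of the residue map. -/

namespace twistedGroupCStar

section Bicharacter

variable {G : Type} [AddCommGroup G] {σ : G → G → Circle} {q : ℕ} [NeZero q] {c : Circle}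
  (hc : orderOf c = q) (r : G →+ ZMod q × ZMod q)
  (hσ : ∀ g h, σ g h = c ^ ((r g).1 * (r h).2).val)

include hc hσ

/-- A representation of `C*(G, σ)` is faithful if every character of the kernel of `r` is induced
by it. -/
theorem injective_of_kernel_characters (hr : Function.Surjective r) {B : Type*} [CStarAlgebra B]
    (π : twistedGroupCStar G σ →⋆ₐ[ℂ] B)
    (hπ : ∀ f : G → Circle, (∀ g h, r g = 0 → r h = 0 → f (g + h) = f g * f h) →
      ∃ (D : Type) (_ : CStarAlgebra D) (_ : Nontrivial D) (ε : B →⋆ₐ[ℂ] D), ∀ g, r g = 0 →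
        ε (π (W G σ g)) = algebraMap ℂ D (f g)) :
    Function.Injective π := by
  classical
  refine injective_of_characters hc r hσ hr π fun φ => ?_
  have hmem : ∀ g, r g = 0 →
      W G σ g ∈ (StarAlgebra.adjoin ℂ (W G σ '' {g | r g = 0})).topologicalClosure := fun g hg =>
    StarSubalgebra.le_topologicalClosure _ (StarAlgebra.subset_adjoin ℂ _ ⟨g, hg, rfl⟩)
  have hnorm : ∀ g (hg : r g = 0), φ ⟨W G σ g, hmem g hg⟩ ∈ Submonoid.unitSphere ℂ := by
    intro g hg
    have hu : (⟨W G σ g, hmem g hg⟩ :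
        (StarAlgebra.adjoin ℂ (W G σ '' {g | r g = 0})).topologicalClosure) ∈ unitary _ := by
      have h := Unitary.mem_iff.mp (W_mem_unitary (σ := σ) g)
      exact Unitary.mem_iff.mpr ⟨Subtype.ext h.1, Subtype.ext h.2⟩
    have hu' : φ ⟨W G σ g, hmem g hg⟩ ∈ unitary ℂ := Unitary.map_mem φ hu
    exact mem_sphere_zero_iff_norm.mpr (CStarRing.norm_of_mem_unitary hu')
  let f : G → Circle := fun g => if hg : r g = 0 then ⟨φ ⟨W G σ g, hmem g hg⟩, hnorm g hg⟩ else 1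
  have hf : ∀ g (hg : r g = 0), (f g : ℂ) = φ ⟨W G σ g, hmem g hg⟩ := fun g hg =>
    congrArg (fun z : Circle => (z : ℂ)) (dif_pos hg)
  obtain ⟨D, i₁, i₂, ε, hε⟩ := hπ f fun g h hg hh => by
    have hgh : r (g + h) = 0 := by rw [map_add, hg, hh, add_zero]
    ext
    rw [Circle.coe_mul, hf g hg, hf h hh, hf _ hgh, ← map_mul]
    congr 1
    refine Subtype.ext ?_
    change _ = W G σ g * W G σ h
    -- The bicharacter is trivial on the kernel, so the canonical unitaries multiply there without a
    -- twist.
    rw [W_mul_W, hσ, hg]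
    simp
  refine ⟨D, i₁, i₂, ε, ?_⟩
  rintro _ ⟨g, hg, rfl⟩
  rw [hε g hg, hf g hg]

end Bicharacter

end twistedGroupCStar

/-! ### Matrix-valued functions on the solenoid -/

/-- The function `z ↦ f z • T`. -/
def smulMat {X : Type*} [TopologicalSpace X] {q : ℕ} (f : C(X, ℂ)) (T : MatAlg q) :
    C(X, MatAlg q) :=
  (⟨fun c => c • T, by fun_prop⟩ : C(ℂ, MatAlg q)).comp f

instance (q : ℕ) : FiniteDimensional ℂ (MatAlg q) :=
  Module.Finite.equiv (CStarMatrix.ofMatrixₗ (m := Fin q) (n := Fin q) (A := ℂ) (R := ℂ))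

theorem continuousMap_mem_of_smulMat_mem {X : Type*} [TopologicalSpace X] {q : ℕ}
    (K : Submodule ℂ C(X, MatAlg q)) (hK : ∀ f T, smulMat f T ∈ K) (ζ : C(X, MatAlg q)) :
    ζ ∈ K := by
  let b := Module.finBasis ℂ (MatAlg q)
  have h : ζ = ∑ i, smulMat
      ((⟨b.coord i, (b.coord i).continuous_of_finiteDimensional⟩ : C(MatAlg q, ℂ)).comp ζ) (b i) := by
    ext1 x
    rw [ContinuousMap.sum_apply]
    exact (b.sum_repr (ζ x)).symm
  rw [h]
  exact K.sum_mem fun i _ => hK _ _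

section Solenoid

variable {N : ℕ} [NeZero N] {k : ℕ} {q : ℕ} [NeZero q] {c : Circle}
  (hk : 0 < k) (hNq : N.Coprime q) (hkq : ((N ^ k : ℕ) : ZMod q) = 1) (hc : orderOf c = q)
  (hcM : c ^ (N ^ k) = c)

/-- The pair of residues of a pair of `N`-adic rationals. -/
def residuePair (hNq : N.Coprime q) : NadicRat N × NadicRat N →+ ZMod q × ZMod q :=
  (NadicRat.residue hNq).prodMap (NadicRat.residue hNq)

theorem residuePair_surjective : Function.Surjective (residuePair hNq) :=
  Function.Surjective.prodMap (NadicRat.residue_surjective hNq) (NadicRat.residue_surjective hNq)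

/-- The image of the canonical unitary of a pair of `N`-adic rationals in the algebra of
matrix-valued functions. -/
def solenoidGen (k : ℕ) (c : Circle) (hNq : N.Coprime q) (g : NadicRat N × NadicRat N) :
    MatFun q (N ^ k) :=
  smulMat (solenoidCharMap k g)
    (weyl c (residuePair hNq g).2 (-(residuePair hNq g).1) : MatAlg q)

theorem solenoidGen_mem_unitary (g : NadicRat N × NadicRat N) :
    solenoidGen k c hNq g ∈ unitary (MatFun q (N ^ k)) := by
  have h : ∀ x, solenoidGen k c hNq g x ∈ unitary (MatAlg q) := by
    intro x
    have h1 := (weyl c (residuePair hNq g).2 (-(residuePair hNq g).1)).2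
    change (solenoidCharMap k g x) • (weyl c (residuePair hNq g).2 (-(residuePair hNq g).1) : MatAlg q)
      ∈ _
    have h2 : star (solenoidCharMap k g x) * solenoidCharMap k g x = 1 := by
      change (starRingEnd ℂ) ((solenoidChar g.1 x.1 * solenoidChar g.2 x.2 : Circle) : ℂ) *
        ((solenoidChar g.1 x.1 * solenoidChar g.2 x.2 : Circle) : ℂ) = 1
      rw [← Circle.coe_inv_eq_conj, ← Circle.coe_mul, inv_mul_cancel, Circle.coe_one]
    rw [Unitary.mem_iff] at h1 ⊢
    rw [star_smul, smul_mul_smul_comm, smul_mul_smul_comm, h1.1, h1.2, mul_comm (solenoidCharMap k g x),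
      h2, one_smul]
    exact ⟨rfl, rfl⟩
  rw [Unitary.mem_iff]
  constructor <;> ext1 x
  · exact (Unitary.mem_iff.mp (h x)).1
  · exact (Unitary.mem_iff.mp (h x)).2

-- The exponents in `solenoidGen` are chosen for this: with b = -r(g)₁ and a' = r(h)₂ the Weyl
-- factor c^(-ba') is exactly the bicharacter.
include hk hc in
theorem solenoidGen_mul (g h : NadicRat N × NadicRat N) :
    solenoidGen k c hNq g * solenoidGen k c hNq h =
      ((c ^ ((residuePair hNq g).1 * (residuePair hNq h).2).val : Circle) : ℂ) •
        solenoidGen k c hNq (g + h) := by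
  have hq : c ^ q = 1 := hc ▸ pow_orderOf_eq_one c
  ext1 x
  change (solenoidCharMap k g x • (weyl c (residuePair hNq g).2 (-(residuePair hNq g).1) : MatAlg q)) *
    (solenoidCharMap k h x • (weyl c (residuePair hNq h).2 (-(residuePair hNq h).1) : MatAlg q)) =
    (_ : ℂ) • (solenoidCharMap k (g + h) x •
      (weyl c (residuePair hNq (g + h)).2 (-(residuePair hNq (g + h)).1) : MatAlg q))
  rw [smul_mul_smul_comm, weyl_mul_weyl hq, ← ContinuousMap.mul_apply, solenoidCharMap_mul hk,
    smul_comm, map_add, neg_mul, neg_neg, Prod.fst_add, Prod.snd_add, neg_add]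

/-- The representation of the noncommutative solenoid on matrix-valued functions. -/
def solenoidRep {σ : NadicRat N × NadicRat N → NadicRat N × NadicRat N → Circle} (hk : 0 < k)
    (hc : orderOf c = q)
    (hσ : ∀ g h, σ g h = c ^ ((residuePair hNq g).1 * (residuePair hNq h).2).val) :
    ProjRep (NadicRat N × NadicRat N) σ where
  carrier := MatFun q (N ^ k)
  W := solenoidGen k c hNq
  unitary' := solenoidGen_mem_unitary hNq
  mul' g h := by rw [solenoidGen_mul hk hNq hc, hσ]

include hk hkq hc in
theorem solenoidChar_const_pow_inv (n : ZMod q) (x : NadicRat N) :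
    solenoidChar x (Solenoid.const c hcM ^ n.val)⁻¹ =
      c ^ (n * -(NadicRat.residue hNq x)).val := by
  have hq : c ^ q = 1 := hc ▸ pow_orderOf_eq_one c
  let χ : Solenoid (N ^ k) →* Circle := MonoidHom.mk' (solenoidChar x) (solenoidChar_mul x)
  change χ _ = _
  have h : χ (Solenoid.const c hcM) = c ^ (NadicRat.residue hNq x).val :=
    solenoidChar_const hk hNq hkq hq hcM x
  rw [map_inv, map_pow, h, ← pow_mul]
  refine inv_eq_of_mul_eq_one_left ?_
  rw [← pow_zmod_val_natCast hq (_ * _), ← pow_zmod_val_add q c hq]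
  push_cast
  rw [ZMod.natCast_zmod_val, ZMod.natCast_zmod_val, mul_neg, mul_comm n, neg_add_cancel,
    ZMod.val_zero, pow_zero]

-- Translation scales the character and conjugation scales the matrix, so these functions are joint
-- eigenvectors of the action. The eigenvalue is trivial for all (n, m) exactly when a = r(g)₂ and b
-- = -r(g)₁, the exponents in `solenoidGen`.
include hk hkq hc in
theorem rhoHom_smulMat_weyl (n m a b : ZMod q) (g : NadicRat N × NadicRat N) :
    rhoHom q (N ^ k) c hcM n m (smulMat (solenoidCharMap k g) (weyl c a b : MatAlg q)) =
      ((c ^ (n * (-(residuePair hNq g).1 - b) + m * (a - (residuePair hNq g).2)).val : Circle) : ℂ) •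
        smulMat (solenoidCharMap k g) (weyl c a b : MatAlg q) := by
  have hq : c ^ q = 1 := hc ▸ pow_orderOf_eq_one c
  ext1 x
  rw [rhoHom_apply]
  change conjAut q c n m (((solenoidChar g.1 ((Solenoid.const c hcM ^ n.val)⁻¹ * x.1) *
      solenoidChar g.2 ((Solenoid.const c hcM ^ m.val)⁻¹ * x.2) : Circle) : ℂ) •
        (weyl c a b : MatAlg q)) =
    (_ : ℂ) • (((solenoidChar g.1 x.1 * solenoidChar g.2 x.2 : Circle) : ℂ) • (weyl c a b : MatAlg q))
  rw [map_smul, conjAut_weyl hq, smul_smul, smul_smul, ← Circle.coe_mul, ← Circle.coe_mul,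
    solenoidChar_mul, solenoidChar_mul, solenoidChar_const_pow_inv hk hNq hkq hc,
    solenoidChar_const_pow_inv hk hNq hkq hc]
  congr 2
  have h : n * (-(residuePair hNq g).1 - b) + m * (a - (residuePair hNq g).2) =
      n * -(NadicRat.residue hNq g.1) + m * -(NadicRat.residue hNq g.2) + (m * a - n * b) := by
    change n * (-(NadicRat.residue hNq g.1) - b) + m * (a - NadicRat.residue hNq g.2) = _
    ring
  rw [h, pow_zmod_val_add q c hq, pow_zmod_val_add q c hq]
  ac_rfl

/-- The sum of the translates of a matrix-valued function under the action. -/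
def rhoSum (q M : ℕ) [NeZero q] (c : Circle) (hM : c ^ M = c) : MatFun q M →ₗ[ℂ] MatFun q M :=
  ∑ x : ZMod q × ZMod q, (rhoHom q M c hM x.1 x.2).toAlgHom.toLinearMap

theorem rhoSum_apply (q M : ℕ) [NeZero q] (c : Circle) (hM : c ^ M = c) (ζ : MatFun q M) :
    rhoSum q M c hM ζ = ∑ x : ZMod q × ZMod q, rhoHom q M c hM x.1 x.2 ζ :=
  LinearMap.sum_apply _ _ _

theorem continuous_rhoHom (q M : ℕ) [NeZero q] (c : Circle) (hM : c ^ M = c) (n m : ZMod q) :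
    Continuous (rhoHom q M c hM n m) :=
  StarAlgHom.continuous_of_cstar (A := MatFun q M) (B := MatFun q M) _

theorem continuous_rhoSum (q M : ℕ) [NeZero q] (c : Circle) (hM : c ^ M = c) :
    Continuous (rhoSum q M c hM) := by
  simp_rw [funext (rhoSum_apply q M c hM)]
  exact continuous_finsetSum _ fun x _ => continuous_rhoHom q M c hM x.1 x.2

include hk hkq hc in
/-- A closed subspace containing the canonical unitaries contains the sum over the action of any
matrix-valued function. -/
theorem rhoSum_mem (K : Submodule ℂ (MatFun q (N ^ k))) (hKc : IsClosed (K : Set (MatFun q (N ^ k))))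
    (hK : ∀ g, solenoidGen k c hNq g ∈ K) (ζ : MatFun q (N ^ k)) :
    rhoSum q (N ^ k) c hcM ζ ∈ K := by
  refine continuousMap_mem_of_smulMat_mem (K.comap (rhoSum q (N ^ k) c hcM)) (fun f T => ?_) ζ
  -- Linearity in the matrix reduces to Weyl products; linearity and continuity in the function then
  -- reduce to characters of the solenoid.
  let TL : MatAlg q →ₗ[ℂ] MatFun q (N ^ k) :=
    { toFun := fun T => smulMat f T
      map_add' := fun T T' => by ext1 x; exact smul_add (f x) T T'
      map_smul' := fun r T => by ext1 x; exact smul_comm (f x) r T }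
  refine span_weyl hc ((K.comap (rhoSum q (N ^ k) c hcM)).comap TL) (fun a b => ?_) T
  let fL : C(Solenoid (N ^ k) × Solenoid (N ^ k), ℂ) →ₗ[ℂ] MatFun q (N ^ k) :=
    { toFun := fun f => smulMat f (weyl c a b : MatAlg q)
      map_add' := fun f f' => by ext1 x; exact add_smul (f x) (f' x) _
      map_smul' := fun r f => by ext1 x; exact smul_assoc r (f x) _ }
  have hfL : Continuous fL := ContinuousMap.continuous_postcomp _
  have hle : Submodule.span ℂ (Set.range (solenoidCharMap (N := N) k)) ≤
      (K.comap (rhoSum q (N ^ k) c hcM)).comap fL := by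
    rw [Submodule.span_le]
    rintro _ ⟨g, rfl⟩
    change rhoSum q (N ^ k) c hcM (smulMat (solenoidCharMap k g) (weyl c a b : MatAlg q)) ∈ K
    rw [rhoSum_apply]
    simp_rw [rhoHom_smulMat_weyl hk hNq hkq hc hcM]
    -- By orthogonality the sum is 0 or q² times a canonical generator.
    rw [← Finset.sum_smul, coe_sum_pow_zmod_mul_add q c hc]
    split_ifs with h0
    · refine K.smul_mem _ ?_
      rw [sub_eq_zero.mp h0.2, ← sub_eq_zero.mp h0.1]
      exact hK g
    · rw [zero_smul]
      exact K.zero_mem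
  exact closure_minimal (s := (Submodule.span ℂ (Set.range (solenoidCharMap (N := N) k)) : Set _)) hle
    ((hKc.preimage (continuous_rhoSum _ _ _ _)).preimage hfL)
    ((closure_span_solenoidCharMap (N := N) hk).symm ▸ Set.mem_univ f)

include hk hkq hc in
/-- The twisted group algebra of a bicharacter pulled back from `ℤ / q ℤ` is the fixed-point algebra
of the action on matrix-valued functions. -/
theorem nonempty_twistedGroupCStar_equiv_fixedPointAlgebra
    {σ : NadicRat N × NadicRat N → NadicRat N × NadicRat N → Circle}
    (hσ : ∀ g h, σ g h = c ^ ((residuePair hNq g).1 * (residuePair hNq h).2).val)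
    (hq : c ^ q = 1) :
    Nonempty (twistedGroupCStar (NadicRat N × NadicRat N) σ ≃⋆ₐ[ℂ]
      fixedPointAlgebra (A := MatFun q (N ^ k)) (rho q (N ^ k) c hcM hq)) := by
  obtain ⟨π₀, hπ₀, -⟩ := twistedGroupCStar.existsUnique_lift _ _ (solenoidRep hNq hk hc hσ)
  let π : twistedGroupCStar (NadicRat N × NadicRat N) σ →⋆ₐ[ℂ] MatFun q (N ^ k) := π₀
  have hπ : ∀ g, π (twistedGroupCStar.W _ σ g) = solenoidGen k c hNq g := hπ₀
  have hinj : Function.Injective π := by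
    obtain ⟨t, ht⟩ : ∃ t, N ^ k = 1 + q * t := by
      have h1 : 1 ≤ N ^ k := Nat.one_le_pow _ _ (NeZero.pos N)
      have h2 : ((N ^ k - 1 : ℕ) : ZMod q) = 0 := by
        rw [Nat.cast_sub h1, hkq, Nat.cast_one, sub_self]
      obtain ⟨t, ht⟩ := (ZMod.natCast_eq_zero_iff _ _).mp h2
      exact ⟨t, by omega⟩
    refine twistedGroupCStar.injective_of_kernel_characters (B := MatFun q (N ^ k)) hc
      (residuePair hNq) hσ (residuePair_surjective hNq) π fun f hf => ?_
    have hl : ∀ x : NadicRat N, NadicRat.residue hNq x = 0 → residuePair hNq (x, 0) = 0 :=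
      fun x hx => Prod.ext hx (map_zero (NadicRat.residue hNq))
    have hr : ∀ x : NadicRat N, NadicRat.residue hNq x = 0 → residuePair hNq (0, x) = 0 :=
      fun x hx => Prod.ext (map_zero (NadicRat.residue hNq)) hx
    -- The character of the kernel is the product of its restrictions to the two axes, each given by
    -- a solenoid point. Evaluation at (z, w) induces it, since the Weyl factor is 1 on the kernel.
    obtain ⟨z, hz⟩ := exists_solenoidChar_eq hk hNq ht (fun x => f (x, 0)) fun x y hx hy => by
      rw [← hf _ _ (hl x hx) (hl y hy), Prod.mk_add_mk, add_zero]
    obtain ⟨w, hw⟩ := exists_solenoidChar_eq hk hNq ht (fun x => f (0, x)) fun x y hx hy => by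
      rw [← hf _ _ (hr x hx) (hr y hy), Prod.mk_add_mk, add_zero]
    let ε : MatFun q (N ^ k) →⋆ₐ[ℂ] MatAlg q :=
      { toFun := fun ζ => ζ (z, w)
        map_one' := rfl
        map_mul' := fun _ _ => rfl
        map_zero' := rfl
        map_add' := fun _ _ => rfl
        commutes' := fun _ => rfl
        map_star' := fun _ => rfl }
    refine ⟨MatAlg q, inferInstance, inferInstance, ε, fun g hg => ?_⟩
    rw [hπ]
    have h1 : NadicRat.residue hNq g.1 = 0 := congrArg Prod.fst hg
    have h2 : NadicRat.residue hNq g.2 = 0 := congrArg Prod.snd hg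
    have h3 : f g = solenoidChar g.1 z * solenoidChar g.2 w := by
      rw [← hz _ h1, ← hw _ h2, ← hf _ _ (hl _ h1) (hr _ h2),
        Prod.mk_add_mk, add_zero, zero_add]
    change ((solenoidChar g.1 z * solenoidChar g.2 w : Circle) : ℂ) •
      (weyl c (residuePair hNq g).2 (-(residuePair hNq g).1) : MatAlg q) = _
    rw [hg, h3, Algebra.algebraMap_eq_smul_one, Prod.fst_zero, Prod.snd_zero, neg_zero, weyl_zero,
      OneMemClass.coe_one]
  have hπc : Continuous π := StarAlgHom.continuous_of_cstar (B := MatFun q (N ^ k)) π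
  have hrho : ∀ (x : Multiplicative (ZMod q × ZMod q)) (ζ : MatFun q (N ^ k)),
      rho q (N ^ k) c hcM hq x ζ = rhoHom q (N ^ k) c hcM x.toAdd.1 x.toAdd.2 ζ := fun _ _ => rfl
  have hfixed : ∀ a, π a ∈ fixedPointAlgebra (A := MatFun q (N ^ k)) (rho q (N ^ k) c hcM hq) := by
    intro a x
    rw [hrho]
    have h1 : IsClosed {a | rhoHom q (N ^ k) c hcM x.toAdd.1 x.toAdd.2 (π a) = π a} :=
      isClosed_eq ((continuous_rhoHom _ _ _ _ _ _).comp hπc) hπc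
    have hle : Submodule.span ℂ (Set.range (twistedGroupCStar.W _ σ)) ≤
        LinearMap.eqLocus ((rhoHom q (N ^ k) c hcM x.toAdd.1 x.toAdd.2).toAlgHom.toLinearMap.comp
          π.toAlgHom.toLinearMap) π.toAlgHom.toLinearMap := by
      rw [Submodule.span_le]
      rintro _ ⟨g, rfl⟩
      change rhoHom q (N ^ k) c hcM x.toAdd.1 x.toAdd.2 (π _) = π _
      rw [hπ, solenoidGen, rhoHom_smulMat_weyl hk hNq hkq hc hcM]
      simp
    exact closure_minimal (s := (Submodule.span ℂ (Set.range (twistedGroupCStar.W _ σ)) : Set _)) hle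
      h1 ((twistedGroupCStar.closure_span_W (σ := σ)).symm ▸ Set.mem_univ a)
  refine ⟨StarAlgEquiv.ofBijective (π.codRestrict _ hfixed) ⟨fun a b h =>
    hinj (congrArg Subtype.val h), ?_⟩⟩
  rintro ⟨ζ, hζ⟩
  have hclosed : IsClosed (Set.range π) :=
    (NonUnitalStarAlgHom.isometry (B := MatFun q (N ^ k)) π hinj).isClosedEmbedding.isClosed_range
  -- An injective star-homomorphism is isometric, so its range is a closed subspace and contains the
  -- sum of the translates of ζ, which is q² ζ when ζ is fixed.
  have h1 := rhoSum_mem hk hNq hkq hc hcM (LinearMap.range π.toAlgHom.toLinearMap)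
    hclosed (fun g => ⟨_, hπ g⟩) ζ
  have h2 : rhoSum q (N ^ k) c hcM ζ = ((q : ℂ) ^ 2) • ζ := by
    have h3 : ∀ x : ZMod q × ZMod q, rhoHom q (N ^ k) c hcM x.1 x.2 ζ = ζ := fun x =>
      hζ (Multiplicative.ofAdd x)
    rw [rhoSum_apply]
    simp_rw [h3]
    simp [sq, ← Nat.cast_smul_eq_nsmul ℂ]
  rw [h2] at h1
  have hq0 : (q : ℂ) ^ 2 ≠ 0 := pow_ne_zero _ (by exact_mod_cast NeZero.ne q)
  rw [Submodule.smul_mem_iff _ hq0] at h1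
  obtain ⟨a, ha⟩ := h1
  exact ⟨a, Subtype.ext ha⟩

end Solenoid

/-! ### Local roots -/

/-- The branch of the `q`-th root on the circle cut at the point opposite to `a`. -/
def circleRoot (q : ℕ) (a b : Circle) : Circle :=
  Circle.exp (((b * a⁻¹ : Circle) : ℂ).arg / q) * Circle.exp ((a : ℂ).arg / q)

theorem circleRoot_pow (q : ℕ) [NeZero q] (a b : Circle) : circleRoot q a b ^ q = b := by
  have hq : (q : ℝ) ≠ 0 := by exact_mod_cast NeZero.ne q
  rw [circleRoot, mul_pow, ← Circle.exp_natCast_mul, ← Circle.exp_natCast_mul,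
    mul_div_cancel₀ _ hq, mul_div_cancel₀ _ hq, Circle.exp_arg, Circle.exp_arg, inv_mul_cancel_right]

/-- The circle cut at the point opposite to `a`. -/
def cutCircle (a : Circle) : Set Circle := {b | ((b * a⁻¹ : Circle) : ℂ) ∈ Complex.slitPlane}

theorem continuous_coe_mul_inv (a : Circle) :
    Continuous fun b : Circle => ((b * a⁻¹ : Circle) : ℂ) := by
  fun_prop

theorem isOpen_cutCircle (a : Circle) : IsOpen (cutCircle a) :=
  Complex.isOpen_slitPlane.preimage (continuous_coe_mul_inv a)

theorem self_mem_cutCircle (a : Circle) : a ∈ cutCircle a := by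
  change ((a * a⁻¹ : Circle) : ℂ) ∈ Complex.slitPlane
  rw [mul_inv_cancel, Circle.coe_one]
  exact Complex.one_mem_slitPlane

theorem continuousOn_circleRoot (q : ℕ) (a : Circle) :
    ContinuousOn (circleRoot q a) (cutCircle a) := by
  intro b hb
  refine ContinuousAt.continuousWithinAt ?_
  have h1 : ContinuousAt (fun b : Circle => ((b * a⁻¹ : Circle) : ℂ).arg) b :=
    ContinuousAt.comp (g := Complex.arg) (Complex.continuousAt_arg hb)
      (continuous_coe_mul_inv a).continuousAt
  exact (Circle.exp.continuous.continuousAt.comp (h1.div_const _)).mul continuousAt_const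

section SolenoidRoots

variable {M q t : ℕ} [NeZero q] (hM : M = 1 + q * t)

/-- The local section of the `q`-th power map of the solenoid given by a branch of the root of the
first coordinate. -/
def solenoidRoot (a : Circle) (s : Solenoid M) : Solenoid M :=
  ⟨solenoidLift t s.1 (circleRoot q a (s.1 0)), solenoidLift_mem hM s.2 (circleRoot_pow q a _)⟩

theorem solenoidRoot_pow (a : Circle) (s : Solenoid M) : solenoidRoot hM a s ^ q = s :=
  Subtype.ext (funext fun n => solenoidLift_pow hM s.2 (circleRoot_pow q a _) n)

/-- The branch of the root enters only in the first coordinate; each later one is a continuous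
expression in the previous one and s. -/
theorem continuousOn_solenoidRoot (a : Circle) :
    ContinuousOn (solenoidRoot (q := q) hM a) {s | s.1 0 ∈ cutCircle a} := by
  have hcoord : ∀ n, Continuous fun s : Solenoid M => s.1 n := fun n =>
    (continuous_apply n).comp continuous_subtype_val
  refine Topology.IsInducing.subtypeVal.continuousOn_iff.mpr (continuousOn_pi.mpr fun n => ?_)
  induction n with
  | zero =>
    exact (continuousOn_circleRoot q a).comp (hcoord 0).continuousOn fun _ hs => hs
  | succ n ih => exact ih.mul ((hcoord (n + 1)).pow t).inv.continuousOn

/-- The local section of the `q`-th power map of the square of the solenoid. -/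
def solenoidSqRoot (i : Circle × Circle) (s : Solenoid M × Solenoid M) : Solenoid M × Solenoid M :=
  (solenoidRoot hM i.1 s.1, solenoidRoot hM i.2 s.2)

theorem solenoidSqRoot_pow (i : Circle × Circle) (s : Solenoid M × Solenoid M) :
    solenoidSqRoot hM i s ^ q = s :=
  Prod.ext (solenoidRoot_pow hM i.1 s.1) (solenoidRoot_pow hM i.2 s.2)

/-- The domain of continuity of a local section. -/
def cutSolenoidSq (M : ℕ) (i : Circle × Circle) : Set (Solenoid M × Solenoid M) :=
  {s | s.1.1 0 ∈ cutCircle i.1 ∧ s.2.1 0 ∈ cutCircle i.2}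

theorem isOpen_cutSolenoidSq (M : ℕ) (i : Circle × Circle) : IsOpen (cutSolenoidSq M i) := by
  have h : Continuous fun s : Solenoid M => s.1 0 := (continuous_apply 0).comp continuous_subtype_val
  exact ((isOpen_cutCircle i.1).preimage (h.comp continuous_fst)).inter
    ((isOpen_cutCircle i.2).preimage (h.comp continuous_snd))

theorem continuousOn_solenoidSqRoot (i : Circle × Circle) :
    ContinuousOn (solenoidSqRoot (q := q) hM i) (cutSolenoidSq M i) :=
  ((continuousOn_solenoidRoot hM i.1).comp continuousOn_fst fun _ hs => hs.1).prodMk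
    ((continuousOn_solenoidRoot hM i.2).comp continuousOn_snd fun _ hs => hs.2)

end SolenoidRoots

/-! ### The deck transformations of the power map -/

section Deck

variable {q M : ℕ} [NeZero q] {c : Circle} (hc : orderOf c = q) (hcM : c ^ M = c)

include hc

theorem exists_pow_zmod_val_eq {x : Circle} (hx : x ^ q = 1) : ∃ n : ZMod q, c ^ n.val = x := by
  have hprim : IsPrimitiveRoot c q := hc ▸ IsPrimitiveRoot.orderOf c
  have hprim' : IsPrimitiveRoot (c : ℂ) q :=
    hprim.map_of_injective (f := Circle.coeHom) Circle.coe_injective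
  obtain ⟨i, hi, hix⟩ := hprim'.eq_pow_of_pow_eq_one (ξ := (x : ℂ))
    (by rw [← Circle.coe_pow, hx, Circle.coe_one])
  refine ⟨i, ?_⟩
  rw [pow_zmod_val_natCast hprim.pow_eq_one]
  ext
  rw [Circle.coe_pow, hix]

theorem pow_zmod_val_injective : Function.Injective fun n : ZMod q => c ^ n.val := by
  intro n m h
  have h1 : n.val % orderOf c = m.val % orderOf c := pow_inj_mod.mp (by simpa [pow_mod_orderOf] using h)
  rw [hc, Nat.mod_eq_of_lt (ZMod.val_lt n), Nat.mod_eq_of_lt (ZMod.val_lt m)] at h1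
  exact ZMod.val_injective q h1

omit hc in
/-- The translation by `(cⁿ, cᵐ)`, as a point of the square of the solenoid. -/
def deckPoint (g : ZMod q × ZMod q) : Solenoid M × Solenoid M :=
  (Solenoid.const c hcM ^ g.1.val, Solenoid.const c hcM ^ g.2.val)

omit [NeZero q] in
theorem const_pow_card : Solenoid.const c hcM ^ q = 1 :=
  Subtype.ext (funext fun _ => hc ▸ pow_orderOf_eq_one c)

theorem deckPoint_add (g h : ZMod q × ZMod q) :
    deckPoint hcM (g + h) = deckPoint hcM g * deckPoint hcM h := by
  simp only [deckPoint, Prod.fst_add, Prod.snd_add, Prod.mk_mul_mk,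
    pow_zmod_val_add q _ (const_pow_card hc hcM)]

omit [NeZero q] in
theorem deckPoint_pow (g : ZMod q × ZMod q) : deckPoint hcM g ^ q = 1 := by
  refine Prod.ext ?_ ?_
  · change (Solenoid.const c hcM ^ g.1.val) ^ q = 1
    rw [← pow_mul, mul_comm, pow_mul, const_pow_card hc, one_pow]
  · change (Solenoid.const c hcM ^ g.2.val) ^ q = 1
    rw [← pow_mul, mul_comm, pow_mul, const_pow_card hc, one_pow]

theorem deckPoint_injective : Function.Injective (deckPoint (q := q) hcM) := by
  intro g h hgh
  have h1 : c ^ g.1.val = c ^ h.1.val :=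
    congrArg (fun x : Solenoid M × Solenoid M => x.1.1 0) hgh
  have h2 : c ^ g.2.val = c ^ h.2.val :=
    congrArg (fun x : Solenoid M × Solenoid M => x.2.1 0) hgh
  exact Prod.ext (pow_zmod_val_injective hc h1) (pow_zmod_val_injective hc h2)

open Classical in
omit hc in
/-- The exponent of a power of `c`. -/
def circleLog (q : ℕ) [NeZero q] (c x : Circle) : ZMod q :=
  if h : ∃ n : ZMod q, c ^ n.val = x then h.choose else 0

theorem pow_circleLog {x : Circle} (hx : x ^ q = 1) : c ^ (circleLog q c x).val = x := by
  have h := exists_pow_zmod_val_eq hc hx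
  rw [circleLog, dif_pos h]
  exact h.choose_spec

theorem continuousOn_circleLog : ContinuousOn (circleLog q c) {x | x ^ q = 1} := by
  refine Set.Finite.continuousOn (Set.Finite.subset
    (Set.finite_range fun n : ZMod q => c ^ n.val) ?_) _
  intro x hx
  exact exists_pow_zmod_val_eq hc hx

omit hc in
/-- The exponents of a point of the kernel of the `q`-th power map. -/
def deckLog (q : ℕ) [NeZero q] (c : Circle) (x : Solenoid M × Solenoid M) : ZMod q × ZMod q :=
  (circleLog q c (x.1.1 0), circleLog q c (x.2.1 0))

variable {t : ℕ} (hM : M = 1 + q * t)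

include hM

/-- If z^q = 1 then z_n = z_(n+1)^(1+qt) = z_(n+1), so z is constant. Hence the kernel of the q-th
power map consists of the deck translations alone. -/
theorem deckPoint_deckLog {x : Solenoid M × Solenoid M} (hx : x ^ q = 1) :
    deckPoint hcM (deckLog q c x) = x := by
  have key : ∀ z : Solenoid M, z ^ q = 1 →
      Solenoid.const c hcM ^ (circleLog q c (z.1 0)).val = z := by
    intro z hz
    have hzn : ∀ n, z.1 n ^ q = 1 := fun n => congrArg (fun z : Solenoid M => z.1 n) hz
    refine Subtype.ext (funext fun n => ?_)
    have h1 : z.1 n = z.1 0 := by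
      induction n with
      | zero => rfl
      | succ n ih =>
        have h2 : z.1 (n + 1) ^ (1 + q * t) = z.1 n := hM ▸ z.2 n
        rw [← ih, ← h2, pow_add, pow_mul, hzn, one_pow, mul_one, pow_one]
    rw [h1]
    exact pow_circleLog hc (hzn 0)
  exact Prod.ext (key x.1 (congrArg Prod.fst hx)) (key x.2 (congrArg Prod.snd hx))

theorem deckLog_deckPoint (g : ZMod q × ZMod q) : deckLog q c (deckPoint hcM g) = g :=
  deckPoint_injective hc hcM (deckPoint_deckLog hc hcM hM (deckPoint_pow hc hcM g))

include hcM

theorem deckLog_mul {x y : Solenoid M × Solenoid M} (hx : x ^ q = 1) (hy : y ^ q = 1) :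
    deckLog q c (x * y) = deckLog q c x + deckLog q c y := by
  refine deckPoint_injective hc hcM ?_
  rw [deckPoint_add hc hcM, deckPoint_deckLog hc hcM hM hx, deckPoint_deckLog hc hcM hM hy,
    deckPoint_deckLog hc hcM hM (by rw [mul_pow, hx, hy, mul_one])]

omit hcM hM

theorem continuousOn_deckLog : ContinuousOn (deckLog (M := M) q c) {x | x ^ q = 1} := by
  have h : Continuous fun s : Solenoid M => s.1 0 := (continuous_apply 0).comp continuous_subtype_val
  have h1 : Set.MapsTo (fun x : Solenoid M × Solenoid M => x.1.1 0) {x | x ^ q = 1}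
      {x | x ^ q = 1} := fun x hx =>
    congrArg (fun z : Solenoid M × Solenoid M => z.1.1 0) (show x ^ q = 1 from hx)
  have h2 : Set.MapsTo (fun x : Solenoid M × Solenoid M => x.2.1 0) {x | x ^ q = 1}
      {x | x ^ q = 1} := fun x hx =>
    congrArg (fun z : Solenoid M × Solenoid M => z.2.1 0) (show x ^ q = 1 from hx)
  exact ((continuousOn_circleLog hc).comp (h.comp continuous_fst).continuousOn h1).prodMk
    ((continuousOn_circleLog hc).comp (h.comp continuous_snd).continuousOn h2)

omit hc

/-- The identification of the values of an invariant function at two points of the same fibre of the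
`q`-th power map. -/
def transport (q : ℕ) [NeZero q] (c : Circle) (x y : Solenoid M × Solenoid M) :
    MatAlg q ≃⋆ₐ[ℂ] MatAlg q :=
  conjAut q c (deckLog q c (x / y)).1 (deckLog q c (x / y)).2

theorem conjAut_zero : conjAut q c 0 0 = 1 := by
  simp [conjAut]

theorem continuous_conjAut (n m : ZMod q) : Continuous (conjAut q c n m) := by
  rw [funext (conjAut_eq_weyl n m)]
  fun_prop

/-- The exponents live in a discrete group, so they are eventually constant and a single continuous
automorphism remains. -/
theorem tendsto_conjAut {X : Type*} {l : Filter X} {g : X → ZMod q × ZMod q} {T : X → MatAlg q}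
    {g₀ : ZMod q × ZMod q} {T₀ : MatAlg q} (hg : Filter.Tendsto g l (nhds g₀))
    (hT : Filter.Tendsto T l (nhds T₀)) :
    Filter.Tendsto (fun x => conjAut q c (g x).1 (g x).2 (T x)) l
      (nhds (conjAut q c g₀.1 g₀.2 T₀)) := by
  rw [nhds_discrete, Filter.tendsto_pure] at hg
  refine (((continuous_conjAut g₀.1 g₀.2).tendsto T₀).comp hT).congr' ?_
  filter_upwards [hg] with x hx
  rw [hx]
  rfl

include hc hcM hM

theorem transport_comp {x y z : Solenoid M × Solenoid M} (hxy : x ^ q = y ^ q) (hyz : y ^ q = z ^ q)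
    (T : MatAlg q) : transport q c x y (transport q c y z T) = transport q c x z T := by
  have h1 : (x / y) ^ q = 1 := by rw [div_pow, hxy, div_self']
  have h2 : (y / z) ^ q = 1 := by rw [div_pow, hyz, div_self']
  have h3 := deckLog_mul hc hcM hM h1 h2
  rw [div_mul_div_cancel] at h3
  rw [transport, transport, transport, h3, Prod.fst_add, Prod.snd_add,
    conjAut_add q c (hc ▸ pow_orderOf_eq_one c)]
  rfl

theorem transport_deckPoint_mul (g : ZMod q × ZMod q) (x : Solenoid M × Solenoid M) :
    transport q c (deckPoint hcM g * x) x = conjAut q c g.1 g.2 := by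
  rw [transport, mul_div_cancel_right, deckLog_deckPoint hc hcM hM]

theorem transport_self (x : Solenoid M × Solenoid M) (T : MatAlg q) : transport q c x x T = T := by
  have h := transport_deckPoint_mul hc hcM hM 0 x
  have h0 : deckPoint hcM (0 : ZMod q × ZMod q) = 1 := by simp [deckPoint]
  rw [h0, one_mul] at h
  rw [h]
  exact congrFun (congrArg DFunLike.coe conjAut_zero) T

omit hcM hM

theorem continuousOn_transport {X : Type*} [TopologicalSpace X] {U : Set X}
    {f g : X → Solenoid M × Solenoid M} {T : X → MatAlg q} (hf : ContinuousOn f U)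
    (hg : ContinuousOn g U) (hT : ContinuousOn T U) (hfg : ∀ x ∈ U, f x ^ q = g x ^ q) :
    ContinuousOn (fun x => transport q c (f x) (g x) (T x)) U := by
  have h0 : ContinuousOn (fun x => f x / g x) U := hf.div' hg
  have h1 : ContinuousOn (fun x => deckLog q c (f x / g x)) U := by
    refine (continuousOn_deckLog (M := M) hc).comp h0 fun x hx => ?_
    change (f x / g x) ^ q = 1
    rw [div_pow, hfg x hx, div_self']
  exact fun x hx => tendsto_conjAut (h1 x hx) (hT x hx)

/-! ### The bundle -/

-- Two points with the same q-th power differ by a unique deck translation, so invariance under the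
-- group is a compatibility between values on each fibre of the power map.
include hcM hM in
theorem mem_fixedPointAlgebra_iff (hq : c ^ q = 1) (ζ : MatFun q M) :
    ζ ∈ fixedPointAlgebra (A := MatFun q M) (rho q M c hcM hq) ↔
      ∀ x y, x ^ q = y ^ q → ζ x = transport q c x y (ζ y) := by
  have hrho : ∀ (g : ZMod q × ZMod q) (x : Solenoid M × Solenoid M),
      rho q M c hcM hq (Multiplicative.ofAdd g) ζ x =
        conjAut q c g.1 g.2 (ζ ((deckPoint hcM g)⁻¹ * x)) := fun g x =>
    rhoHom_apply q M c hcM g.1 g.2 ζ x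
  constructor
  · intro h x y hxy
    have h1 : (x / y) ^ q = 1 := by rw [div_pow, hxy, div_self']
    have h2 := hrho (deckLog q c (x / y)) x
    rw [h (Multiplicative.ofAdd _), deckPoint_deckLog hc hcM hM h1, inv_div, div_mul_cancel] at h2
    exact h2
  · intro h g
    obtain ⟨g, rfl⟩ := Multiplicative.ofAdd.surjective g
    ext1 x
    rw [hrho, ← transport_deckPoint_mul hc hcM hM g ((deckPoint hcM g)⁻¹ * x),
      mul_inv_cancel_left]
    refine (h x _ ?_).symm
    rw [mul_pow, inv_pow, deckPoint_pow hc, inv_one, one_mul]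

end Deck

section Bundle

variable {q M : ℕ} [NeZero q] {c : Circle} {t : ℕ}

/-- The cocycle of the bundle of matrix algebras over the square of the solenoid. -/
def solenoidBundleCore (hc : orderOf c = q) (hcM : c ^ M = c) (hM : M = 1 + q * t) :
    FiberBundleCore (Circle × Circle) (Solenoid M × Solenoid M) (MatAlg q) where
  baseSet := cutSolenoidSq M
  isOpen_baseSet := isOpen_cutSolenoidSq M
  indexAt b := (b.1.1 0, b.2.1 0)
  mem_baseSet_at b := ⟨self_mem_cutCircle _, self_mem_cutCircle _⟩
  -- In chart i a fibre element over b is a value at the i-th root of b; passing to chart j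
  -- transports it to the j-th root.
  coordChange i j b T := transport q c (solenoidSqRoot hM j b) (solenoidSqRoot hM i b) T
  coordChange_self i b _ T := transport_self hc hcM hM _ T
  continuousOn_coordChange i j := by
    refine continuousOn_transport hc
      ((continuousOn_solenoidSqRoot hM j).comp continuousOn_fst fun x hx => hx.1.2)
      ((continuousOn_solenoidSqRoot hM i).comp continuousOn_fst fun x hx => hx.1.1)
      continuousOn_snd fun x _ => ?_
    rw [solenoidSqRoot_pow, solenoidSqRoot_pow]
  coordChange_comp i j k b _ T := transport_comp hc hcM hM
    (by rw [solenoidSqRoot_pow, solenoidSqRoot_pow])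
    (by rw [solenoidSqRoot_pow, solenoidSqRoot_pow]) T

/-- The bundle of matrix algebras over the square of the solenoid. -/
def solenoidBundle (hc : orderOf c = q) (hcM : c ^ M = c) (hM : M = 1 + q * t) :
    MatrixBundle (Solenoid M × Solenoid M) q where
  fiber := (solenoidBundleCore hc hcM hM).Fiber
  cstar _ := inferInstanceAs (CStarAlgebra (MatAlg q))
  topTotal := inferInstance
  locallyTrivial b := ⟨(solenoidBundleCore hc hcM hM).localTrivAt b,
    (solenoidBundleCore hc hcM hM).mem_localTrivAt_baseSet b, fun x _ =>
    ⟨transport q c (solenoidSqRoot hM (b.1.1 0, b.2.1 0) x)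
      (solenoidSqRoot hM (x.1.1 0, x.2.1 0) x), fun _ => rfl⟩⟩

/-- The continuous sections of the bundle. -/
theorem mem_solenoidBundle_sections_iff (hc : orderOf c = q) (hcM : c ^ M = c) (hM : M = 1 + q * t)
    (s : Solenoid M × Solenoid M → MatAlg q) :
    (show ∀ b, (solenoidBundle hc hcM hM).fiber b from s) ∈ (solenoidBundle hc hcM hM).sections ↔
      ∀ b : Solenoid M × Solenoid M, ContinuousAt (fun x =>
        transport q c (solenoidSqRoot hM (b.1.1 0, b.2.1 0) x)
          (solenoidSqRoot hM (x.1.1 0, x.2.1 0) x) (s x)) b := by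
  change Continuous _ ↔ _
  rw [continuous_iff_continuousAt]
  exact forall_congr' fun b => (solenoidBundle hc hcM hM).continuousAt_iff
    ((solenoidBundleCore hc hcM hM).localTrivAt b)
    ((solenoidBundleCore hc hcM hM).mem_localTrivAt_baseSet b) s

/-- The fixed-point algebra is the algebra of continuous sections of the bundle. -/
theorem nonempty_fixedPointAlgebra_equiv_sections (hc : orderOf c = q) (hcM : c ^ M = c)
    (hM : M = 1 + q * t) (hq : c ^ q = 1) :
    Nonempty (fixedPointAlgebra (A := MatFun q M) (rho q M c hcM hq) ≃⋆ₐ[ℂ]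
      (solenoidBundle hc hcM hM).sections) := by
  -- The root belonging to the preferred chart at b. It need not depend continuously on b, so
  -- continuity is always tested in the chart of a fixed base point.
  let τ : Solenoid M × Solenoid M → Solenoid M × Solenoid M := fun b =>
    solenoidSqRoot (q := q) hM (b.1.1 0, b.2.1 0) b
  have hτ : ∀ b, τ b ^ q = b := fun b => solenoidSqRoot_pow hM _ b
  have hinv := fun ζ => mem_fixedPointAlgebra_iff hc hcM hM hq ζ
  let Φ : fixedPointAlgebra (A := MatFun q M) (rho q M c hcM hq) →⋆ₐ[ℂ]
      ∀ b, (solenoidBundle hc hcM hM).fiber b :=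
    { toFun := fun ζ b => ζ.1 (τ b)
      map_one' := rfl
      map_mul' := fun _ _ => rfl
      map_zero' := rfl
      map_add' := fun _ _ => rfl
      commutes' := fun _ => rfl
      map_star' := fun _ => rfl }
  have hΦ : ∀ ζ, Φ ζ ∈ (solenoidBundle hc hcM hM).sections := by
    intro ζ
    refine (mem_solenoidBundle_sections_iff hc hcM hM (fun b => ζ.1 (τ b))).mpr fun b => ?_
    -- By invariance of ζ, the section read in the chart at b is ζ composed with one local root,
    -- which is continuous near b.
    have h1 : ∀ x, transport q c (solenoidSqRoot hM (b.1.1 0, b.2.1 0) x)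
        (solenoidSqRoot hM (x.1.1 0, x.2.1 0) x) (ζ.1 (τ x)) =
          ζ.1 (solenoidSqRoot (q := q) hM (b.1.1 0, b.2.1 0) x) := fun x =>
      ((hinv ζ.1).mp ζ.2 _ _ (by rw [solenoidSqRoot_pow, hτ])).symm
    simp_rw [h1]
    exact ζ.1.continuous.continuousAt.comp ((continuousOn_solenoidSqRoot hM _).continuousAt
      ((isOpen_cutSolenoidSq M _).mem_nhds ⟨self_mem_cutCircle _, self_mem_cutCircle _⟩))
  refine ⟨StarAlgEquiv.ofBijective (Φ.codRestrict _ hΦ) ⟨?_, ?_⟩⟩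
  · intro ζ ξ h
    have h1 : ∀ b, ζ.1 (τ b) = ξ.1 (τ b) := fun b => congrFun (congrArg Subtype.val h) b
    refine Subtype.ext (ContinuousMap.ext fun x => ?_)
    have hx : x ^ q = τ (x ^ q) ^ q := (hτ _).symm
    rw [(hinv ζ.1).mp ζ.2 _ _ hx, (hinv ξ.1).mp ξ.2 _ _ hx, h1]
  · rintro ⟨s, hs⟩
    let s' : Solenoid M × Solenoid M → MatAlg q := s
    have hs' := (mem_solenoidBundle_sections_iff hc hcM hM s').mp hs
    -- The inverse construction: compatibility on fibres leaves no choice but to transport s(x^q)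
    -- from the root τ(x^q) to x.
    have hcont : Continuous fun x : Solenoid M × Solenoid M =>
        transport q c x (τ (x ^ q)) (s' (x ^ q)) := by
      rw [continuous_iff_continuousAt]
      intro x₀
      let i : Circle × Circle := ((x₀ ^ q).1.1 0, (x₀ ^ q).2.1 0)
      have hpow : Continuous fun x : Solenoid M × Solenoid M => x ^ q := continuous_pow q
      have hU : (fun x : Solenoid M × Solenoid M => x ^ q) ⁻¹' cutSolenoidSq M i ∈ nhds x₀ :=
        ((isOpen_cutSolenoidSq M i).preimage hpow).mem_nhds
          ⟨self_mem_cutCircle _, self_mem_cutCircle _⟩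
      -- Factoring through the branch fixed at x₀ removes the dependence on τ: the inner transport
      -- is s in a chart, and the outer one has locally constant exponents.
      have h1 : ∀ x : Solenoid M × Solenoid M, transport q c x (τ (x ^ q)) (s' (x ^ q)) =
          transport q c x (solenoidSqRoot (q := q) hM i (x ^ q))
            (transport q c (solenoidSqRoot (q := q) hM i (x ^ q)) (τ (x ^ q)) (s' (x ^ q))) :=
        fun x => (transport_comp hc hcM hM (by rw [solenoidSqRoot_pow])
          (by rw [solenoidSqRoot_pow, hτ]) _).symm
      simp_rw [h1]
      have h2 : ContinuousAt (fun x : Solenoid M × Solenoid M =>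
          transport q c (solenoidSqRoot (q := q) hM i (x ^ q)) (τ (x ^ q)) (s' (x ^ q))) x₀ :=
        ContinuousAt.comp (f := fun x : Solenoid M × Solenoid M => x ^ q) (hs' (x₀ ^ q))
          hpow.continuousAt
      have h3 : ContinuousOn (fun x : Solenoid M × Solenoid M =>
          deckLog q c (x / solenoidSqRoot (q := q) hM i (x ^ q)))
            ((fun x : Solenoid M × Solenoid M => x ^ q) ⁻¹' cutSolenoidSq M i) :=
        (continuousOn_deckLog hc).comp (continuousOn_id.div'
          ((continuousOn_solenoidSqRoot hM i).comp hpow.continuousOn fun _ hx => hx)) fun x _ => by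
            change (x / solenoidSqRoot (q := q) hM i (x ^ q)) ^ q = 1
            rw [div_pow, solenoidSqRoot_pow, div_self']
      exact tendsto_conjAut (h3.continuousAt hU) h2
    let ζ : MatFun q M := ⟨_, hcont⟩
    have hζ : ζ ∈ fixedPointAlgebra (A := MatFun q M) (rho q M c hcM hq) := by
      refine (hinv ζ).mpr fun x y hxy => ?_
      change transport q c x (τ (x ^ q)) (s' (x ^ q)) =
        transport q c x y (transport q c y (τ (y ^ q)) (s' (y ^ q)))
      rw [transport_comp hc hcM hM hxy (by rw [hτ]), hxy]
    refine ⟨⟨ζ, hζ⟩, Subtype.ext (funext fun b => ?_)⟩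
    change transport q c (τ b) (τ (τ b ^ q)) (s' (τ b ^ q)) = s' b
    rw [hτ, transport_self hc hcM hM]

end Bundle

end

/-! ### The periodic rational case assembled. -/

theorem mainTheorem7 (N : ℕ) [NeZero N] (hN : 1 < N) (α : ℕ → ℝ) (hα : α ∈ Xi N)
    (hper : ∃ j : ℕ, 0 < j ∧ ∀ n, α (n + j) = α n)
    (p q : ℕ) [NeZero q] (hp : p ≠ 0) (hpq : p.Coprime q) (hα0 : α 0 = (p : ℝ) / (q : ℝ))
    (k : ℕ) (hk : IsLeast {l : ℕ | 0 < l ∧ ∃ j : ℤ, ((N : ℝ) ^ l - 1) * α 0 = j} k) :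
    (∃ E : MatrixBundle (Solenoid (N ^ k) × Solenoid (N ^ k)) q,
      Nonempty (NoncommutativeSolenoid N α ≃⋆ₐ[ℂ] E.sections)) ∧
    Nonempty (NoncommutativeSolenoid N α ≃⋆ₐ[ℂ]
      fixedPointAlgebra (A := MatFun q (N ^ k)) (rho q (N ^ k) (rootOfUnity p q) (rootOfUnity_pow_of_int hα0 hk.1.2)
        (rootOfUnity_pow p q))) := by
  have hc := orderOf_rootOfUnity p q hpq
  have hcM : rootOfUnity p q ^ (N ^ k) = rootOfUnity p q := rootOfUnity_pow_of_int hα0 hk.1.2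
  -- λ has order exactly q because p/q is reduced, so λ^(N^k - 1) = 1 gives q ∣ N^k - 1. This one
  -- congruence yields both the coprimality of N and q and the roots in the solenoid.
  obtain ⟨t, ht⟩ : ∃ t, N ^ k = 1 + q * t := by
    have h1 : 1 ≤ N ^ k := Nat.one_le_pow _ _ (NeZero.pos N)
    have h2 : rootOfUnity p q ^ (N ^ k - 1) = 1 := by
      rw [pow_sub _ h1, hcM, pow_one, mul_inv_cancel]
    obtain ⟨t, ht⟩ := orderOf_dvd_of_pow_eq_one h2
    rw [hc] at ht
    exact ⟨t, by omega⟩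
  have hkq : ((N ^ k : ℕ) : ZMod q) = 1 := by
    rw [ht]
    simp
  have hNq : N.Coprime q := by
    have h : (N ^ k).Coprime q := by rw [ht]; simp
    exact Nat.Coprime.coprime_dvd_left (dvd_pow_self N hk.1.1.ne') h
  have hσ : ∀ g h, solenoidMultiplier N α g h =
      rootOfUnity p q ^ ((residuePair hNq g).1 * (residuePair hNq h).2).val := fun g h =>
    solenoidMultiplier_eq_pow hα hNq hper (rootOfUnity_pow p q) (by rw [hα0]; rfl) g h
  obtain ⟨e⟩ := nonempty_twistedGroupCStar_equiv_fixedPointAlgebra hk.1.1 hNq hkq hc hcM hσ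
    (rootOfUnity_pow p q)
  obtain ⟨e'⟩ := nonempty_fixedPointAlgebra_equiv_sections hc hcM ht (rootOfUnity_pow p q)
  exact ⟨⟨solenoidBundle hc hcM ht, ⟨e.trans e'⟩⟩, ⟨e⟩⟩
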